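/- Let $N,k\ge 1$ be integers and $p\in(0,\infty)$. There is a constant $C\in(0,\infty)$, depending only on $N,k,p$, with the following property. Let $X$ be a rearrangement invariant Banach function space on $\mathbb{R}^N$ (in the sense of Bennett--Sharpley) with absolutely continuous norm. Let $\dot W^kX$ be the set of distributions $f$ on $\mathbb{R}^N$ with $\partial^\alpha f\in X$ for all multi-indices $|\alpha|=k$, let $W^kX$ be the set of locally integrable $f$ with $\partial^\alpha f\in X$ for all $|\alpha|\le k$, and let $\|\nabla^kf\|_X:=\big\|\big(\sum_{|\alpha|=k}|\partial^\alpha f|^2\big)^{1/2}\big\|_X$. Put $\Delta_h^kf:=\sum_{j=0}^k(-1)^{j+k}\binom kj f(\cdot+jh)$. Let $\{\rho_\varepsilon\}_{\varepsilon>0}$ be non-negative functions on $(0,\infty)$ with $\int_0^\infty\rho_\varepsilon(t)\,dt=1$, and define $$\phi_\varepsilon(t):=\int_{t^k}^\infty u^{-p-\frac Nk}\rho_\varepsilon(u)\,du,\qquad t>0 .$$ Then, for every $f\in\dot W^kX$ and $\varepsilon>0$, $$\int_{\mathbb{R}^N}\|\Delta_h^kf\|_X^p\,\phi_\varepsilon(|h|)\,dh\le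 C\,\|\nabla^kf\|_X^p .$$ If, in addition, $\lim_{\varepsilon\to0^+}\int_0^a\rho_\varepsilon(t)\,dt=1$ for every $a\in(0,1)$, then for every $f\in\dot W^kX$ $$\lim_{\varepsilon\to0^+}\int_{\mathbb{R}^N}\|\Delta_h^kf\|_X^p\,\phi_\varepsilon(|h|)\,dh=\frac1{kp+N}\int_{\mathbb{S}^{N-1}}\bigg\|\sum_{|\alpha|=k}\frac{k!}{\alpha!}\,\omega^\alpha\partial^\alpha f\bigg\|_X^p\,d\sigma^{N-1}(\omega),$$ where $\sigma^{N-1}$ is the surface measure on the unit sphere $\mathbb{S}^{N-1}$, and for every $f\in W^kX$ $$C^{-1}\|\nabla^kf\|_X^p\le\lim_{\varepsilon\to0^+}\int_{\mathbb{R}^N}\|\Delta_h^kf\|_X^p\,\phi_\varepsilon(|h|)\,dh\le C\,\|\nabla^kf\|_X^p .$$ -/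

import Mathlib

open MeasureTheory Filter Topology
open scoped ENNReal NNReal Distributions LineDeriv

noncomputable section

namespace BBM

/-- `N`-dimensional Euclidean space with its Lebesgue measure. -/
abbrev E (N : ℕ) : Type := EuclideanSpace ℝ (Fin N)

/-- Scalar test functions on `ℝ^N`. -/
abbrev Test (N : ℕ) : Type := 𝓓((⊤ : TopologicalSpace.Opens (E N)), ℝ)

/-- `𝕜`-valued distributions on `ℝ^N`. -/
abbrev Distr (N : ℕ) (𝕜 : Type*) [RCLike 𝕜] : Type _ :=
  𝓓'((⊤ : TopologicalSpace.Opens (E N)), 𝕜)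

/-! ### Rearrangement invariant Banach function spaces -/

/-- A rearrangement invariant Banach function norm on `ℝ^N`. It is a map on the Lebesgue measurable
(that is, a.e. measurable) functions `ℝ^N → [0, ∞]`; its values on other functions are irrelevant.
The space `X` consists of the measurable functions `g` with `norm |g| < ∞`. -/
structure RINorm (N : ℕ) where
  /-- The function norm. -/
  norm : (E N → ℝ≥0∞) → ℝ≥0∞
  norm_eq_zero_iff : ∀ f, AEMeasurable f volume → (norm f = 0 ↔ f =ᵐ[volume] 0)
  norm_mul : ∀ (c : ℝ≥0) (f), AEMeasurable f volume → norm (fun x => c * f x) = c * norm f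
  norm_add_le : ∀ f g, AEMeasurable f volume → AEMeasurable g volume →
    norm (fun x => f x + g x) ≤ norm f + norm g
  norm_mono : ∀ f g, AEMeasurable f volume → AEMeasurable g volume →
    f ≤ᵐ[volume] g → norm f ≤ norm g
  /-- The Fatou property: `f n ↑ ⨆ n, f n` a.e. implies `norm (f n) ↑ norm (⨆ n, f n)`. -/
  norm_iSup : ∀ f : ℕ → E N → ℝ≥0∞, (∀ n, AEMeasurable (f n) volume) →
    (∀ᵐ x ∂volume, Monotone fun n => f n x) → norm (fun x => ⨆ n, f n x) = ⨆ n, norm (f n)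
  norm_indicator_lt_top : ∀ A : Set (E N), MeasurableSet A → volume A < ∞ →
    norm (A.indicator 1) < ∞
  lintegral_le : ∀ A : Set (E N), MeasurableSet A → volume A < ∞ →
    ∃ C : ℝ≥0, ∀ f, AEMeasurable f volume → ∫⁻ x in A, f x ≤ C * norm f
  /-- Equimeasurable functions have the same norm. -/
  norm_eq_of_equimeasurable : ∀ f g, AEMeasurable f volume → AEMeasurable g volume →
    (∀ t : ℝ≥0∞, volume {x | t < f x} = volume {x | t < g x}) → norm f = norm g

/-- `X` has absolutely continuous norm: `‖f 1_{A n}‖ → 0` whenever `f ∈ X` and `1_{A n} → 0` a.e. -/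
def RINorm.HasAbsContNorm {N : ℕ} (X : RINorm N) : Prop :=
  ∀ f, AEMeasurable f volume → X.norm f < ∞ →
    ∀ A : ℕ → Set (E N), (∀ n, MeasurableSet (A n)) →
      (∀ᵐ x ∂volume, ∀ᶠ n in atTop, x ∉ A n) →
        Tendsto (fun n => X.norm ((A n).indicator f)) atTop (𝓝 0)

/-! ### Distributions: regular distributions, derivatives, differences -/

section

variable {N : ℕ} {𝕜 : Type*} [RCLike 𝕜]

/-- The functional `S` on test functions is (integration against) the locally integrable
function `g`. -/
def Represents (S : Test N → 𝕜) (g : E N → 𝕜) : Prop :=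
  LocallyIntegrable g volume ∧ ∀ φ : Test N, S φ = ∫ x, φ x • g x

/-- `S ∈ X`: the functional `S` is a function belonging to `X`. -/
def RINorm.Mem (X : RINorm N) (S : Test N → 𝕜) : Prop :=
  ∃ g, Represents S g ∧ X.norm (fun x => ‖g x‖ₑ) < ∞

/-- `‖S‖_X ∈ [0, ∞]`, equal to `norm |g|` if `S` is the (a.e. unique) function `g`, and to `∞` if
`S` is not a function. -/
def RINorm.distNorm (X : RINorm N) (S : Test N → 𝕜) : ℝ≥0∞ :=
  ⨅ (g : E N → 𝕜) (_ : Represents S g), X.norm (fun x => ‖g x‖ₑ)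

/-- The partial derivative `∂^α f` in the sense of distributions. -/
def partialDeriv (α : Fin N → ℕ) (f : Distr N 𝕜) : Distr N 𝕜 :=
  (List.finRange N).foldr
    (fun i T => (fun S : Distr N 𝕜 => ∂_{(EuclideanSpace.single i 1 : E N)} S)^[α i] T) f

/-- The translated test function `x ↦ φ (x - a)`. -/
def translate (a : E N) (φ : Test N) : Test N where
  toFun x := φ (x - a)
  contDiff' := φ.contDiff.comp (contDiff_id.sub contDiff_const)
  hasCompactSupport' := by
    simpa [sub_eq_add_neg, Function.comp_def] using
      φ.hasCompactSupport.comp_homeomorph (Homeomorph.addRight (-a))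
  tsupport_subset' := by simp

/-- The difference `Δ_h^k f = ∑_{j=0}^k (-1)^{j+k} (k choose j) f(· + j h)` of a distribution `f`,
where `⟨f(· + a), φ⟩ = ⟨f, φ(· - a)⟩`. -/
def diff (k : ℕ) (h : E N) (f : Distr N 𝕜) : Test N → 𝕜 := fun φ =>
  ∑ j ∈ Finset.range (k + 1), ((-1) ^ (j + k) * (k.choose j : ℝ)) • f (translate ((j : ℝ) • h) φ)

/-- The multi-indices `α ∈ ℕ^N` with `|α| = k`. -/
def multiIndices (N k : ℕ) : Finset (Fin N → ℕ) := Finset.piAntidiag Finset.univ k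

/-- The `k`-th directional derivative `∑_{|α|=k} (k!/α!) ω^α ∂^α f`. -/
def dirDeriv (k : ℕ) (ω : E N) (f : Distr N 𝕜) : Distr N 𝕜 :=
  ∑ α ∈ multiIndices N k,
    ((Nat.multinomial Finset.univ α : ℝ) * ∏ i, ω i ^ α i) • partialDeriv α f

/-- The homogeneous Sobolev space `Ẇ^k X`. -/
def RINorm.homSobolev (X : RINorm N) (k : ℕ) (𝕜 : Type*) [RCLike 𝕜] : Set (Distr N 𝕜) :=
  {f | ∀ α : Fin N → ℕ, ∑ i, α i = k → X.Mem (partialDeriv α f)}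

/-- The inhomogeneous Sobolev space `W^k X`. The condition for `α = 0` says that `f` is a (locally
integrable) function in `X`. -/
def RINorm.sobolev (X : RINorm N) (k : ℕ) (𝕜 : Type*) [RCLike 𝕜] : Set (Distr N 𝕜) :=
  {f | ∀ α : Fin N → ℕ, ∑ i, α i ≤ k → X.Mem (partialDeriv α f)}

/-- `‖∇^k f‖_X = ‖ |∇^k f| ‖_X`, where `|∇^k f| = (∑_{|α|=k} |∂^α f|²)^{1/2}`; the functions
`g α = ∂^α f` are unique up to null sets (and the value is `∞` if they do not exist). -/
def RINorm.gradNorm (X : RINorm N) (k : ℕ) (f : Distr N 𝕜) : ℝ≥0∞ :=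
  ⨅ (g : (Fin N → ℕ) → E N → 𝕜)
    (_ : ∀ α ∈ multiIndices N k, Represents (partialDeriv α f) (g α)),
    X.norm (fun x => ENNReal.ofReal (√(∑ α ∈ multiIndices N k, ‖g α x‖ ^ 2)))

end

/-! ### Families of weights -/

/-- `ρ ε`, `ε > 0`, are non-negative functions on `(0, ∞)` with integral one. (A function whose
Bochner integral is `1` is measurable and integrable.) -/
def IsNormalized (ρ : ℝ → ℝ → ℝ) : Prop :=
  ∀ ε > 0, (∀ t > 0, 0 ≤ ρ ε t) ∧ ∫ t in Set.Ioi 0, ρ ε t = 1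

/-- `ρ ε` concentrates at `0` as `ε → 0+`. -/
def Concentrates (ρ : ℝ → ℝ → ℝ) : Prop :=
  ∀ a : ℝ, 0 < a → a < 1 → Tendsto (fun ε => ∫ t in Set.Ioo 0 a, ρ ε t) (𝓝[>] 0) (𝓝 1)

/-- `φ(t) = ∫_{t^k}^∞ u^{-p-N/k} w(u) du`. -/
def phi (N k : ℕ) (p : ℝ) (w : ℝ → ℝ) (t : ℝ) : ℝ≥0∞ :=
  ∫⁻ u in Set.Ioi (t ^ k), ENNReal.ofReal (u ^ (-p - (N : ℝ) / k) * w u)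

/-- `∫_{ℝ^N} ‖Δ_h^k f‖_X^p φ(|h|) dh`. -/
def energy {N : ℕ} {𝕜 : Type*} [RCLike 𝕜] (X : RINorm N) (k : ℕ) (p : ℝ) (w : ℝ → ℝ)
    (f : Distr N 𝕜) : ℝ≥0∞ :=
  ∫⁻ h : E N, X.distNorm (diff k h f) ^ p * phi N k p w ‖h‖

end BBM

end

/-!
Let `f ∈ Ẇ^k X`, choose measurable representatives `g α` of `∂^α f`, `|α| = k`, and put
`G_y = ∑_{|α|=k} (k!/α!) y^α g α`, which represents the directional derivative `∂_y^k f`.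

By Peano's formula there is a probability measure `μ` on `[0, k]` with
`Δ_h^k f = ∫ (∂_h^k f)(· + s h) dμ(s)` in the sense of distributions (`represents_diff`), hence
`‖Δ_{r y}^k f‖_X = r^k Q(r, y)` for `r ≥ 0`, where `Q(r, y)` is the norm of the average
`∫ G_y(· + s r y) dμ(s)` (`RINorm.segNorm`, `RINorm.distNorm_diff`). Two facts about `Q` are needed.
* `Q(r, y) ≤ Q(0, y) = ‖∂_y^k f‖_X`. This is Minkowski's inequality; rearrangement invariance
  enters only through the translation invariance of the norm (`RINorm.segNorm_le_segNorm_zero`).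
* `Q` is lower semicontinuous (`RINorm.lowerSemicontinuous_segNorm`): the averages depend
  continuously on `(r, y)` in `L¹` of balls, and by the Fatou property sublevel sets of the norm are
  closed in that topology.
Consequently `Q(r, y) → Q(0, y)` as `r → 0`.

Let `B(r)` be the integral of `Q(r, y)^p` over the unit ball (`RINorm.ballEnergy`). Then
`B(r) ≤ B(0)`, and `B(r) → B(0)` as `r → 0` by dominated convergence. Tonelli's theorem, and the
substitution `h = u^{1/k} y`, turn the energy into `∫_0^∞ ρ_ε(u) B(u^{1/k}) du`
(`RINorm.energy_eq`). As `ρ_ε` has integral one, the energy is at most `B(0)`, and it tends to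
`B(0)` if the `ρ_ε` concentrate at `0`. Polar coordinates identify `B(0)` with the integral over the
sphere (`RINorm.ballEnergy_zero_eq`).

Finally `B(0)` is comparable to `‖∇^k f‖_X^p`. The upper bound is clear. For the lower bound
(`exists_fullNorm_rpow_le`), the polynomials `(k!/α!) y^α`, `|α| = k`, are linearly independent on
the unit ball, so finitely many of the functions `G_y` determine all `g α`. One of the corresponding
norms `‖G_y‖_X` therefore dominates `‖∇^k f‖_X`, and so do those at all nearby points.
-/

noncomputable section

namespace BBM

/-! ### Rearrangement invariant norms -/

namespace RINorm

variable {N : ℕ} (X : RINorm N)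

theorem norm_congr {f g : E N → ℝ≥0∞} (hf : AEMeasurable f volume) (hg : AEMeasurable g volume)
    (h : f =ᵐ[volume] g) : X.norm f = X.norm g :=
  le_antisymm (X.norm_mono f g hf hg h.le) (X.norm_mono g f hg hf h.symm.le)

theorem norm_zero : X.norm (fun _ => 0) = 0 :=
  (X.norm_eq_zero_iff _ aemeasurable_const).2 (Eventually.of_forall fun _ => rfl)

theorem norm_sum_le {ι : Type*} (s : Finset ι) (f : ι → E N → ℝ≥0∞)
    (hf : ∀ i ∈ s, AEMeasurable (f i) volume) :
    X.norm (fun x => ∑ i ∈ s, f i x) ≤ ∑ i ∈ s, X.norm (f i) := by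
  classical
  induction s using Finset.induction_on with
  | empty => simp [X.norm_zero]
  | insert a s ha ih =>
    simp only [Finset.sum_insert ha]
    refine (X.norm_add_le _ _ (hf a (by simp)) ?_).trans ?_
    · exact Finset.aemeasurable_fun_sum _ fun i hi => hf i (by simp [hi])
    · gcongr
      exact ih fun i hi => hf i (by simp [hi])

/-- Translates are equimeasurable, so the norm is translation invariant. -/
theorem norm_comp_add_right {f : E N → ℝ≥0∞} (hf : AEMeasurable f volume) (a : E N) :
    X.norm (fun x => f (x + a)) = X.norm f :=
  X.norm_eq_of_equimeasurable _ _
    (hf.comp_quasiMeasurePreserving (measurePreserving_add_right volume a).quasiMeasurePreserving)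
    hf fun t => measure_preimage_add_right volume a {x | t < f x}

/-- Lower semicontinuity of the norm under a.e. convergence, from the Fatou property. -/
theorem norm_le_of_tendsto_ae {f : ℕ → E N → ℝ≥0∞} {g : E N → ℝ≥0∞} {c : ℝ≥0∞}
    (hf : ∀ n, AEMeasurable (f n) volume) (hg : AEMeasurable g volume)
    (h : ∀ᵐ x ∂volume, Tendsto (fun n => f n x) atTop (𝓝 (g x)))
    (hc : ∀ n, X.norm (f n) ≤ c) : X.norm g ≤ c := by
  have hF : ∀ m, AEMeasurable (fun x => ⨅ n, f (n + m) x) volume := fun m =>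
    AEMeasurable.iInf fun n => hf (n + m)
  have h1 : X.norm g = X.norm (fun x => ⨆ m, ⨅ n, f (n + m) x) := by
    refine X.norm_congr hg (AEMeasurable.iSup hF) ?_
    filter_upwards [h] with x hx
    rw [← hx.liminf_eq, liminf_eq_iSup_iInf_of_nat']
  rw [h1, X.norm_iSup _ hF]
  · refine iSup_le fun m => (X.norm_mono _ _ (hF m) (hf m) ?_).trans (hc m)
    exact Eventually.of_forall fun x => (iInf_le _ 0).trans (by simp)
  · refine Eventually.of_forall fun x m m' hm => le_iInf fun n => ?_
    refine (iInf_le _ (n + (m' - m))).trans_eq ?_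
    congr 1
    omega

/-- Sublevel sets of the norm are closed under convergence in `L¹` on all balls: on each ball a
subsequence converges almost everywhere, and the balls exhaust the space. -/
theorem norm_le_of_tendsto_lintegral {F : Type*} [NormedAddCommGroup F]
    {f : ℕ → E N → F} {g : E N → F} {c : ℝ≥0∞}
    (hf : ∀ n, AEStronglyMeasurable (f n) volume) (hg : AEStronglyMeasurable g volume)
    (h : ∀ R : ℕ, Tendsto (fun n => ∫⁻ x in Metric.ball 0 R, ‖f n x - g x‖ₑ) atTop (𝓝 0))
    (hc : ∀ n, X.norm (fun x => ‖f n x‖ₑ) ≤ c) : X.norm (fun x => ‖g x‖ₑ) ≤ c := by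
  have hball : ∀ R : ℕ, X.norm ((Metric.ball 0 R).indicator fun x => ‖g x‖ₑ) ≤ c := by
    intro R
    have h1 : TendstoInMeasure (volume.restrict (Metric.ball (0 : E N) R)) f atTop g := by
      refine tendstoInMeasure_of_tendsto_eLpNorm one_ne_zero (fun n => (hf n).restrict)
        hg.restrict ?_
      simpa only [eLpNorm_one_eq_lintegral_enorm, Pi.sub_apply] using h R
    obtain ⟨ns, -, hns⟩ := h1.exists_seq_tendsto_ae
    rw [ae_restrict_iff' measurableSet_ball] at hns
    refine X.norm_le_of_tendsto_ae
      (f := fun n => (Metric.ball 0 R).indicator fun x => ‖f (ns n) x‖ₑ)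
      (fun n => (hf _).enorm.indicator measurableSet_ball) (hg.enorm.indicator measurableSet_ball)
      ?_ fun n => ?_
    · filter_upwards [hns] with x hx
      by_cases hxR : x ∈ Metric.ball (0 : E N) R
      · simpa [Set.indicator_of_mem hxR] using (hx hxR).enorm
      · simp [Set.indicator_of_notMem hxR]
    · refine (X.norm_mono _ _ ((hf _).enorm.indicator measurableSet_ball) (hf _).enorm ?_).trans
        (hc (ns n))
      exact Eventually.of_forall fun x => Set.indicator_le_self _ _ x
  refine X.norm_le_of_tendsto_ae (fun n => hg.enorm.indicator measurableSet_ball) hg.enorm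
    (Eventually.of_forall fun x => ?_) hball
  refine tendsto_const_nhds.congr' ?_
  filter_upwards [eventually_gt_atTop ⌈‖x‖⌉₊] with R hR
  rw [Set.indicator_of_mem]
  simpa using (Nat.le_ceil ‖x‖).trans_lt (by exact_mod_cast hR)

end RINorm

/-! ### Averages of translates -/

section Averages

variable {N : ℕ} {F : Type*} [NormedAddCommGroup F]

/-- Continuity of translation in `L¹`. -/
theorem tendsto_lintegral_translate_sub {G : E N → F} (hG : Integrable G volume)
    {y : ℕ → E N} {z : E N} (hy : Tendsto y atTop (𝓝 z)) :
    Tendsto (fun n => ∫⁻ x, ‖G (x + y n) - G (x + z)‖ₑ) atTop (𝓝 0) := by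
  have hG' : MemLp G 1 volume := memLp_one_iff_integrable.2 hG
  let T : C(E N, C(E N, E N)) := (ContinuousMap.mk fun a : E N × E N => a.2 + a.1).curry
  have hT : ∀ a, MeasurePreserving (T a) (volume : Measure (E N)) volume := fun a =>
    measurePreserving_add_right volume a
  have h1 := (tendsto_const_nhds (x := hG'.toLp G) (f := atTop)).compMeasurePreservingLp
    ((T.continuous.tendsto z).comp hy) (fun n => hT (y n)) (hT z) ENNReal.one_ne_top
  simp only [Lp.toLp_compMeasurePreserving] at h1
  rw [Lp.tendsto_Lp_iff_tendsto_eLpNorm''] at h1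
  simp only [eLpNorm_one_eq_lintegral_enorm] at h1
  exact h1

variable {S : Type*} [MeasurableSpace S] {μ : Measure S}

theorem measurable_lintegral_translate_sub {G : E N → F} (hG : StronglyMeasurable G)
    {Y Z : S → E N} (hY : Measurable Y) (hZ : Measurable Z) :
    Measurable fun s => ∫⁻ x, ‖G (x + Y s) - G (x + Z s)‖ₑ := by
  have h1 : StronglyMeasurable fun q : S × E N => G (q.2 + Y q.1) - G (q.2 + Z q.1) :=
    (hG.comp_measurable (by fun_prop)).sub (hG.comp_measurable (by fun_prop))
  exact h1.enorm.lintegral_prod_right'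

theorem stronglyMeasurable_average [NormedSpace ℝ F] [SFinite μ] {G : E N → F}
    (hG : StronglyMeasurable G) {Y : S → E N} (hY : Measurable Y) :
    StronglyMeasurable fun x => ∫ s, G (x + Y s) ∂μ := by
  have h1 : StronglyMeasurable fun q : E N × S => G (q.1 + Y q.2) :=
    hG.comp_measurable (by fun_prop)
  exact h1.integral_prod_right

theorem lintegral_lintegral_translate [SFinite μ] {g : E N → ℝ≥0∞} (hg : Measurable g)
    {Y : S → E N} (hY : Measurable Y) :
    ∫⁻ x, ∫⁻ s, g (x + Y s) ∂μ = μ Set.univ * ∫⁻ x, g x := by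
  rw [lintegral_lintegral_swap (by fun_prop)]
  simp [lintegral_add_right_eq_self, mul_comm]

theorem integrable_translate_prod [IsFiniteMeasure μ] {G : E N → F} (hGm : StronglyMeasurable G)
    (hG : Integrable G volume) {Y : S → E N} (hY : Measurable Y) :
    Integrable (fun q : E N × S => G (q.1 + Y q.2)) (volume.prod μ) := by
  have hm : StronglyMeasurable fun q : E N × S => G (q.1 + Y q.2) :=
    hGm.comp_measurable (by fun_prop)
  refine ⟨hm.aestronglyMeasurable, ?_⟩
  rw [HasFiniteIntegral, lintegral_prod _ hm.enorm.aemeasurable,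
    lintegral_lintegral_translate hGm.enorm hY]
  exact ENNReal.mul_lt_top (measure_lt_top _ _) hG.2

/-- If the translations `Y n s` converge to `Z s` for every `s`, then the averages of the translates
of an integrable function converge in `L¹`. -/
theorem tendsto_lintegral_average_sub [NormedSpace ℝ F] [IsFiniteMeasure μ] {G : E N → F}
    (hGm : StronglyMeasurable G) (hG : Integrable G volume) {Y : ℕ → S → E N} {Z : S → E N}
    (hY : ∀ n, Measurable (Y n)) (hZ : Measurable Z)
    (h : ∀ s, Tendsto (fun n => Y n s) atTop (𝓝 (Z s))) :
    Tendsto (fun n => ∫⁻ x, ‖(∫ s, G (x + Y n s) ∂μ) - ∫ s, G (x + Z s) ∂μ‖ₑ) atTop (𝓝 0) := by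
  have hint : ∀ W : S → E N, Measurable W →
      ∀ᵐ x ∂volume, Integrable (fun s => G (x + W s)) μ := fun W hW =>
    (integrable_translate_prod (μ := μ) hGm hG hW).prod_right_ae
  have hle : ∀ n, ∫⁻ x, ‖(∫ s, G (x + Y n s) ∂μ) - ∫ s, G (x + Z s) ∂μ‖ₑ ≤
      ∫⁻ s, ∫⁻ x, ‖G (x + Y n s) - G (x + Z s)‖ₑ ∂volume ∂μ := by
    intro n
    rw [lintegral_lintegral_swap]
    · refine lintegral_mono_ae ?_
      filter_upwards [hint _ (hY n), hint _ hZ] with x h1 h2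
      rw [← integral_sub h1 h2]
      exact enorm_integral_le_lintegral_enorm _
    · have hYn := hY n
      exact ((hGm.comp_measurable (g := fun q : S × E N => q.2 + Y n q.1) (by fun_prop)).sub
        (hGm.comp_measurable (g := fun q : S × E N => q.2 + Z q.1)
          (by fun_prop))).enorm.aemeasurable
  refine tendsto_of_tendsto_of_tendsto_of_le_of_le tendsto_const_nhds ?_ (fun _ => zero_le) hle
  have hdom := tendsto_lintegral_of_dominated_convergence (μ := μ)
    (F := fun n s => ∫⁻ x, ‖G (x + Y n s) - G (x + Z s)‖ₑ) (f := fun _ => 0)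
    (fun _ => 2 * ∫⁻ x, ‖G x‖ₑ)
    (fun n => measurable_lintegral_translate_sub hGm (hY n) hZ) ?_ ?_ ?_
  · simpa using hdom
  · refine fun n => Eventually.of_forall fun s => ?_
    calc ∫⁻ x, ‖G (x + Y n s) - G (x + Z s)‖ₑ
        ≤ ∫⁻ x, (‖G (x + Y n s)‖ₑ + ‖G (x + Z s)‖ₑ) := lintegral_mono fun x => enorm_sub_le
      _ = 2 * ∫⁻ x, ‖G x‖ₑ := by
        rw [lintegral_add_left (f := fun x => ‖G (x + Y n s)‖ₑ)
            (hGm.comp_measurable (measurable_add_const _)).enorm,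
          lintegral_add_right_eq_self (fun x => ‖G x‖ₑ),
          lintegral_add_right_eq_self (fun x => ‖G x‖ₑ), two_mul]
  · rw [lintegral_const]
    exact (ENNReal.mul_lt_top (ENNReal.mul_lt_top (by simp) hG.2) (measure_lt_top _ _)).ne
  · exact Eventually.of_forall fun s => tendsto_lintegral_translate_sub hG (h s)

/-- An average over finitely many translations does not increase the norm. -/
theorem RINorm.norm_lintegral_simpleFunc_le (X : RINorm N) {g : E N → ℝ≥0∞} (hg : Measurable g)
    [IsProbabilityMeasure μ] (Y : SimpleFunc S (E N)) :
    X.norm (fun x => ∫⁻ s, g (x + Y s) ∂μ) ≤ X.norm g := by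
  have h1 : ∀ x, ∫⁻ s, g (x + Y s) ∂μ = ∑ z ∈ Y.range, g (x + z) * μ (Y ⁻¹' {z}) := fun x => by
    have := SimpleFunc.lintegral_eq_lintegral (Y.map fun z => g (x + z)) μ
    rw [SimpleFunc.map_lintegral] at this
    rw [← this]
    rfl
  have h2 : ∀ z, X.norm (fun x => g (x + z) * μ (Y ⁻¹' {z})) = μ (Y ⁻¹' {z}) * X.norm g := by
    intro z
    have hz : μ (Y ⁻¹' {z}) = ((μ (Y ⁻¹' {z})).toNNReal : ℝ≥0∞) :=
      (ENNReal.coe_toNNReal (measure_ne_top _ _)).symm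
    rw [hz, ← X.norm_comp_add_right hg.aemeasurable z, ← X.norm_mul _ _ (by fun_prop)]
    simp only [mul_comm]
  simp only [h1]
  refine (X.norm_sum_le _ _ fun z _ => by fun_prop).trans ?_
  simp only [h2, ← Finset.sum_mul]
  have h3 : ∑ z ∈ Y.range, μ (Y ⁻¹' {z}) = 1 := by
    rw [SimpleFunc.sum_range_measure_preimage_singleton, measure_univ]
  rw [h3, one_mul]

/-- Minkowski's integral inequality for averages of translates: they do not increase the norm. For
integrable `g` the map `Y` is approximated by simple functions, because translations act
continuously on `L¹`; the general case follows by monotone convergence. -/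
theorem RINorm.norm_lintegral_translate_le (X : RINorm N) {g : E N → ℝ≥0∞} (hg : Measurable g)
    [IsProbabilityMeasure μ] {Y : S → E N} (hY : Measurable Y) :
    X.norm (fun x => ∫⁻ s, g (x + Y s) ∂μ) ≤ X.norm g := by
  -- The truncations of `g` are bounded with bounded support, hence integrable.
  let t : ℕ → E N → ℝ≥0∞ := fun m => (Metric.ball 0 m).indicator fun x => min (g x) m
  have htm : ∀ m, Measurable (t m) := fun m =>
    (hg.min measurable_const).indicator measurableSet_ball
  have htle : ∀ m x, t m x ≤ m := fun m x =>
    (Set.indicator_le_self _ _ x).trans (min_le_right _ _)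
  have htg : ∀ m x, t m x ≤ g x := fun m x =>
    (Set.indicator_le_self _ _ x).trans (min_le_left _ _)
  have htmono : Monotone t := by
    intro m m' hm x
    refine (Set.indicator_le_indicator_of_subset (Metric.ball_subset_ball (by exact_mod_cast hm))
      (fun _ => zero_le) x).trans (Set.indicator_le_indicator ?_)
    gcongr
  have htsup : ∀ x, ⨆ m, t m x = g x := by
    intro x
    refine le_antisymm (iSup_le fun m => htg m x) (le_of_forall_lt fun c hc => ?_)
    obtain ⟨n, hn⟩ := ENNReal.exists_nat_gt hc.ne_top
    let m := max n (⌈‖x‖⌉₊ + 1)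
    have hx : x ∈ Metric.ball (0 : E N) m := by
      have h1 : ‖x‖ < ⌈‖x‖⌉₊ + 1 := (Nat.le_ceil ‖x‖).trans_lt (lt_add_one _)
      have h2 : ((⌈‖x‖⌉₊ + 1 : ℕ) : ℝ) ≤ m := by exact_mod_cast le_max_right _ _
      push_cast at h2
      simpa using h1.trans_le h2
    refine lt_of_lt_of_le ?_ (le_iSup (fun m => t m x) m)
    simp only [t, Set.indicator_of_mem hx]
    exact lt_min hc (hn.trans_le (by exact_mod_cast le_max_left _ _))
  have hav : ∀ m, Measurable fun x => ∫⁻ s, t m (x + Y s) ∂μ := fun m => by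
    have : Measurable fun q : E N × S => t m (q.1 + Y q.2) := (htm m).comp (by fun_prop)
    exact this.lintegral_prod_right'
  have key : ∀ m, X.norm (fun x => ∫⁻ s, t m (x + Y s) ∂μ) ≤ X.norm (t m) := by
    intro m
    let G : E N → ℝ := fun x => (t m x).toReal
    have htop : ∀ x, t m x ≠ ∞ := fun x => ne_top_of_le_ne_top (by simp) (htle m x)
    have hGe : ∀ x, ‖G x‖ₑ = t m x := fun x => by
      rw [Real.enorm_eq_ofReal ENNReal.toReal_nonneg, ENNReal.ofReal_toReal (htop x)]
    have hGm : StronglyMeasurable G := (htm m).ennreal_toReal.stronglyMeasurable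
    have hG : Integrable G volume := by
      refine ⟨hGm.aestronglyMeasurable, ?_⟩
      simp only [HasFiniteIntegral, hGe]
      calc ∫⁻ x, t m x ≤ ∫⁻ x, (Metric.ball (0 : E N) m).indicator (fun _ => (m : ℝ≥0∞)) x :=
            lintegral_mono fun x => Set.indicator_le_indicator (min_le_right _ _)
        _ = m * volume (Metric.ball (0 : E N) m) := by
            rw [lintegral_indicator measurableSet_ball, setLIntegral_const]
        _ < ∞ := ENNReal.mul_lt_top (by simp) measure_ball_lt_top
    have hGav : ∀ W : S → E N, Measurable W → ∀ x,
        ‖∫ s, G (x + W s) ∂μ‖ₑ = ∫⁻ s, t m (x + W s) ∂μ := by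
      intro W hW x
      have hlt : ∫⁻ s, t m (x + W s) ∂μ ≠ ∞ := by
        refine ne_top_of_le_ne_top ?_ (lintegral_mono fun s => htle m (x + W s))
        simp
      rw [integral_toReal (f := fun s => t m (x + W s)) (μ := μ)
        ((htm m).comp (measurable_const.add hW)).aemeasurable
        (Eventually.of_forall fun s => (htop _).lt_top),
        Real.enorm_eq_ofReal ENNReal.toReal_nonneg, ENNReal.ofReal_toReal hlt]
    let W : ℕ → SimpleFunc S (E N) := fun n =>
      SimpleFunc.approxOn Y hY Set.univ 0 (Set.mem_univ _) n
    have hW : ∀ s, Tendsto (fun n => W n s) atTop (𝓝 (Y s)) := fun s =>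
      SimpleFunc.tendsto_approxOn hY (Set.mem_univ _) (by simp)
    have hlim := tendsto_lintegral_average_sub (μ := μ) hGm hG (Y := fun n => W n)
      (fun n => (W n).measurable) hY hW
    have := X.norm_le_of_tendsto_lintegral (c := X.norm (t m))
      (fun n => (stronglyMeasurable_average (μ := μ) hGm (W n).measurable).aestronglyMeasurable)
      (stronglyMeasurable_average (μ := μ) hGm hY).aestronglyMeasurable
      (fun R => tendsto_of_tendsto_of_tendsto_of_le_of_le tendsto_const_nhds hlim
        (fun _ => zero_le) fun n => setLIntegral_le_lintegral _ _) ?_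
    · simpa only [hGav Y hY] using this
    · intro n
      simp only [hGav _ (W n).measurable]
      exact X.norm_lintegral_simpleFunc_le (htm m) (W n)
  have hsup : ∀ x, ∫⁻ s, g (x + Y s) ∂μ = ⨆ m, ∫⁻ s, t m (x + Y s) ∂μ := fun x => by
    rw [← lintegral_iSup (f := fun m s => t m (x + Y s))
      (fun m => (htm m).comp (measurable_const.add hY)) fun m m' h s => htmono h _]
    simp only [htsup]
  simp only [hsup]
  rw [X.norm_iSup _ (fun m => (hav m).aemeasurable)]
  · refine iSup_le fun m => (key m).trans ?_
    exact X.norm_mono _ _ (htm m).aemeasurable hg.aemeasurable (Eventually.of_forall (htg m))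
  · exact Eventually.of_forall fun x m m' h => lintegral_mono fun s => htmono h _

end Averages

/-! ### Translation and differentiation of test functions and distributions -/

/-- Symmetry of the second derivative, with the first directional derivative taken along `a`. -/
theorem fderiv_fderiv_apply_comm {E' F : Type*} [NormedAddCommGroup E'] [NormedSpace ℝ E']
    [NormedAddCommGroup F] [NormedSpace ℝ F] {g : E' → F} (hg : ContDiff ℝ 2 g) (x a b : E') :
    fderiv ℝ (fun y => fderiv ℝ g y a) x b = fderiv ℝ (fderiv ℝ g) x a b := by
  have h1 : DifferentiableAt ℝ (fderiv ℝ g) x :=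
    ((hg.fderiv_right (m := 1) (by norm_num)).differentiable one_ne_zero) x
  have h2 : fderiv ℝ (fun y => fderiv ℝ g y a) x b = fderiv ℝ (fderiv ℝ g) x b a := by
    rw [fderiv_clm_apply h1 (differentiableAt_const a)]
    simp
  rw [h2]
  exact (hg.contDiffAt.isSymmSndFDerivAt (by simp)) b a

theorem contDiff_iteratedFDeriv {E' F : Type*} [NormedAddCommGroup E'] [NormedSpace ℝ E']
    [NormedAddCommGroup F] [NormedSpace ℝ F] {g : E' → F} (hg : ContDiff ℝ (⊤ : ℕ∞) g) (i : ℕ) :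
    ContDiff ℝ (⊤ : ℕ∞) (iteratedFDeriv ℝ i g) :=
  contDiff_infty.2 fun n => (contDiff_infty.1 hg (n + i)).iteratedFDeriv_right (by push_cast; rfl)

theorem iteratedFDeriv_fderiv_apply {E' F : Type*} [NormedAddCommGroup E'] [NormedSpace ℝ E']
    [NormedAddCommGroup F] [NormedSpace ℝ F] {g : E' → F} (hg : ContDiff ℝ (⊤ : ℕ∞) g) (a : E')
    (i : ℕ) :
    iteratedFDeriv ℝ i (fun y => fderiv ℝ g y a) =
      fun x => fderiv ℝ (iteratedFDeriv ℝ i g) x a := by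
  induction i with
  | zero =>
    ext x m
    have h0 : iteratedFDeriv ℝ 0 g =
        (continuousMultilinearCurryFin0 ℝ E' F).symm.toContinuousLinearEquiv ∘ g := rfl
    rw [h0, ContinuousLinearEquiv.comp_fderiv]
    simp
  | succ i ih =>
    have hi : ContDiff ℝ 2 (iteratedFDeriv ℝ i g) :=
      contDiff_infty.1 (contDiff_iteratedFDeriv hg i) 2
    have hi' : ∀ x, DifferentiableAt ℝ (fderiv ℝ (iteratedFDeriv ℝ i g)) x := fun x =>
      ((hi.fderiv_right (m := 1) (by norm_num)).differentiable one_ne_zero) x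
    ext x m
    have h1 : fderiv ℝ (iteratedFDeriv ℝ (i + 1) g) x a m =
        fderiv ℝ (fun y => fderiv ℝ (iteratedFDeriv ℝ i g) y (m 0) (Fin.tail m)) x a :=
      (fderiv_continuousMultilinear_apply_const_apply
        (((contDiff_iteratedFDeriv hg (i + 1)).differentiable (by simp)) x) m a).symm
    rw [iteratedFDeriv_succ_apply_left, ih, h1, fderiv_fderiv_apply_comm hi,
      fderiv_continuousMultilinear_apply_const_apply
        ((hi' x).clm_apply (differentiableAt_const (m 0))),
      fderiv_fderiv_apply_comm hi, (hi.contDiffAt.isSymmSndFDerivAt (by simp)) a (m 0)]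

theorem contDiff_fderiv {E' F : Type*} [NormedAddCommGroup E'] [NormedSpace ℝ E']
    [NormedAddCommGroup F] [NormedSpace ℝ F] {g : E' → F} (hg : ContDiff ℝ (⊤ : ℕ∞) g) :
    ContDiff ℝ (⊤ : ℕ∞) (fderiv ℝ g) :=
  contDiff_infty.2 fun n => (contDiff_infty.1 hg (n + 1)).fderiv_right (by push_cast; rfl)

/-- First order Taylor expansion, uniformly in the base point. -/
theorem exists_norm_slope_add_fderiv_le {E' F : Type*} [NormedAddCommGroup E'] [NormedSpace ℝ E']
    [NormedAddCommGroup F] [NormedSpace ℝ F] {Ψ : E' → F} (hΨ : ContDiff ℝ (⊤ : ℕ∞) Ψ)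
    (hs : HasCompactSupport Ψ) (h : E') :
    ∃ C : ℝ, 0 ≤ C ∧ ∀ t : ℝ, t ≠ 0 → ∀ x,
      ‖t⁻¹ • (Ψ (x - t • h) - Ψ x) + fderiv ℝ Ψ x h‖ ≤ |t| * C := by
  obtain ⟨L, hL⟩ := (contDiff_fderiv hΨ).lipschitzWith_of_hasCompactSupport (hs.fderiv ℝ) (by simp)
  refine ⟨L * ‖h‖ * ‖h‖, by positivity, fun t ht x => ?_⟩
  have hseg : ∀ z ∈ segment ℝ x (x - t • h),
      ‖fderiv ℝ Ψ z - fderiv ℝ Ψ x‖ ≤ L * (|t| * ‖h‖) := by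
    intro z hz
    rw [← dist_eq_norm]
    refine (hL.dist_le_mul z x).trans ?_
    gcongr
    obtain ⟨θ, hθ, rfl⟩ := (segment_eq_image' ℝ x (x - t • h) ▸ hz :)
    rw [dist_eq_norm]
    simp only [add_sub_cancel_left, sub_sub_cancel_left, norm_smul, norm_neg]
    rw [Real.norm_eq_abs, Real.norm_eq_abs, abs_of_nonneg hθ.1]
    exact mul_le_of_le_one_left (by positivity) hθ.2
  have hmv := (convex_segment x (x - t • h)).norm_image_sub_le_of_norm_fderiv_le'
    (f := Ψ) (φ := fderiv ℝ Ψ x)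
    (fun z _ => (hΨ.differentiable (by simp)) z) hseg (left_mem_segment ℝ _ _)
    (right_mem_segment ℝ _ _)
  simp only [sub_sub_cancel_left, map_neg, map_smul, sub_neg_eq_add, norm_neg, norm_smul,
    Real.norm_eq_abs] at hmv
  have h5 : t⁻¹ • (Ψ (x - t • h) - Ψ x) + fderiv ℝ Ψ x h =
      t⁻¹ • (Ψ (x - t • h) - Ψ x + t • fderiv ℝ Ψ x h) := by
    rw [smul_add, smul_smul, inv_mul_cancel₀ ht, one_smul]
  rw [h5, norm_smul, norm_inv, Real.norm_eq_abs]
  have htpos : 0 < |t| := abs_pos.2 ht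
  calc |t|⁻¹ * _ ≤ |t|⁻¹ * (L * (|t| * ‖h‖) * (|t| * ‖h‖)) := by gcongr
    _ = |t| * (L * ‖h‖ * ‖h‖) := by field_simp

/-- The remainder of a difference quotient of `g` has as its derivatives the remainders for the
derivatives of `g`; so one uniform estimate handles all orders. -/
theorem iteratedFDeriv_slope_add {E' F : Type*} [NormedAddCommGroup E'] [NormedSpace ℝ E']
    [NormedAddCommGroup F] [NormedSpace ℝ F] {g : E' → F} (hg : ContDiff ℝ (⊤ : ℕ∞) g)
    (i : ℕ) (c : ℝ) (a h x : E') :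
    iteratedFDeriv ℝ i (fun y => c • (g (y - a) - g y) + fderiv ℝ g y h) x =
      c • (iteratedFDeriv ℝ i g (x - a) - iteratedFDeriv ℝ i g x) +
        fderiv ℝ (iteratedFDeriv ℝ i g) x h := by
  have hg' := contDiff_infty.1 hg i
  have hc1 : ContDiff ℝ i fun y => g (y - a) := hg'.comp (contDiff_id.sub contDiff_const)
  have hc2 : ContDiff ℝ i ((fun y => g (y - a)) - g) := hc1.sub hg'
  have hc3 : ContDiff ℝ i fun y => fderiv ℝ g y h :=
    (contDiff_infty.1 (contDiff_fderiv hg) i).clm_apply contDiff_const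
  have h1 : (fun y => c • (g (y - a) - g y) + fderiv ℝ g y h) =
      c • ((fun y => g (y - a)) - g) + fun y => fderiv ℝ g y h := rfl
  have hc4 : ContDiff ℝ i (c • ((fun y => g (y - a)) - g)) := hc2.const_smul c
  rw [h1, iteratedFDeriv_add hc4 hc3, iteratedFDeriv_fderiv_apply hg,
    Pi.add_apply, iteratedFDeriv_const_smul_apply hc2.contDiffAt, iteratedFDeriv_sub hc1 hg',
    Pi.sub_apply, iteratedFDeriv_comp_sub]

section TestFunctions

variable {N : ℕ}

theorem translate_apply (a : E N) (φ : Test N) (x : E N) : translate a φ x = φ (x - a) := rfl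

theorem translate_translate (a b : E N) (φ : Test N) :
    translate a (translate b φ) = translate (a + b) φ := by
  ext x
  simp only [translate_apply]
  congr 1
  abel

theorem lineDeriv_test_apply (v : E N) (φ : Test N) (x : E N) :
    (∂_{v} φ : Test N) x = fderiv ℝ φ x v := by
  rw [TestFunction.lineDerivOp_eq_lineDerivCLM ℝ, TestFunction.lineDerivCLM_eq_fderivCLM,
    TestFunction.fderivCLM_apply_of_le _ (by simp)]

/-- The difference quotients of the translates of a test function converge in the topology of
test functions. -/
theorem tendsto_slope_translate (φ : Test N) (h : E N) :
    Tendsto (fun t : ℝ => t⁻¹ • (translate (t • h) φ - φ) + ∂_{h} φ) (𝓝[≠] 0) (𝓝 0) := by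
  set r : ℝ → Test N := fun t => t⁻¹ • (translate (t • h) φ - φ) + ∂_{h} φ with hr
  have hr_apply : ∀ t x, r t x = t⁻¹ • (φ (x - t • h) - φ x) + fderiv ℝ φ x h := by
    intro t x
    rw [← lineDeriv_test_apply]
    rfl
  -- All remainders with `|t| ≤ 1` are supported in one compact set.
  let K : TopologicalSpace.Compacts (E N) :=
    ⟨(fun q : ℝ × E N => q.2 + q.1 • h) '' (Set.Icc (-1) 1 ×ˢ tsupport φ),
      (isCompact_Icc.prod φ.hasCompactSupport).image (by fun_prop)⟩
  have hK : ∀ t ∈ Set.Icc (-1 : ℝ) 1, Function.support (r t) ⊆ K := by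
    intro t ht x hx
    by_contra hxK
    apply hx
    have h1 : ∀ s ∈ Set.Icc (-1 : ℝ) 1, x - s • h ∉ tsupport φ := fun s hs hmem =>
      hxK ⟨(s, x - s • h), ⟨hs, hmem⟩, by simp⟩
    have h2 : x ∉ tsupport φ := by simpa using h1 0 (by simp)
    rw [hr_apply, image_eq_zero_of_notMem_tsupport (h1 t ht),
      image_eq_zero_of_notMem_tsupport h2,
      image_eq_zero_of_notMem_tsupport (f := fderiv ℝ φ)
        (fun h3 => h2 (tsupport_fderiv_subset ℝ h3))]
    simp
  classical
  let Q : ℝ → 𝓓^{⊤}_{K}(E N, ℝ) := fun t =>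
    if ht : Function.support (r t) ⊆ K then .of_support_subset (r t).contDiff ht else 0
  have hQ : ∀ t ∈ Set.Icc (-1 : ℝ) 1, ⇑(Q t) = r t := by
    intro t ht
    simp only [Q, dif_pos (hK t ht)]
    rfl
  have hIcc : ∀ᶠ t : ℝ in 𝓝[≠] 0, t ∈ Set.Icc (-1 : ℝ) 1 :=
    nhdsWithin_le_nhds (Icc_mem_nhds (by norm_num) (by norm_num))
  -- By uniform Taylor expansions of all derivatives the remainders tend to `0` in the Fréchet space
  -- of smooth functions supported in `K`, which embeds continuously into the test functions.
  have hQlim : Tendsto Q (𝓝[≠] 0) (𝓝 0) := by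
    rw [nhds_iInf, tendsto_iInf]
    intro i
    rw [nhds_induced, tendsto_comap_iff, map_zero]
    obtain ⟨C, hC0, hC⟩ := exists_norm_slope_add_fderiv_le (contDiff_iteratedFDeriv φ.contDiff i)
      (φ.hasCompactSupport.iteratedFDeriv i) h
    have hbound : ∀ᶠ t : ℝ in 𝓝[≠] 0,
        ‖ContDiffMapSupportedIn.structureMapLM ℝ ⊤ i (Q t)‖ ≤ |t| * C := by
      filter_upwards [hIcc, self_mem_nhdsWithin] with t ht ht0
      rw [BoundedContinuousFunction.norm_le (by positivity)]
      intro x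
      have h1 : ⇑(r t) = fun y => t⁻¹ • (φ (y - t • h) - φ y) + fderiv ℝ φ y h :=
        funext (hr_apply t)
      rw [ContDiffMapSupportedIn.structureMapLM_top_apply, hQ t ht, h1,
        iteratedFDeriv_slope_add φ.contDiff]
      exact hC t ht0 x
    refine (tendsto_zero_iff_norm_tendsto_zero
      (E := BoundedContinuousFunction (E N) (E N [×i]→L[ℝ] ℝ))).2 ?_
    refine squeeze_zero' (Eventually.of_forall fun _ => norm_nonneg _) hbound ?_
    have : Tendsto (fun t : ℝ => |t| * C) (𝓝 0) (𝓝 (|0| * C)) :=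
      (continuous_abs.mul continuous_const).tendsto 0
    simpa using this.mono_left nhdsWithin_le_nhds
  have hKtop : (K : Set (E N)) ⊆ (⊤ : TopologicalSpace.Opens (E N)) := fun _ _ => trivial
  have h1 := ((TestFunction.continuous_ofSupportedIn (n := ⊤) (F := ℝ) hKtop).tendsto 0).comp hQlim
  have h2 : TestFunction.ofSupportedIn hKtop (0 : 𝓓^{⊤}_{K}(E N, ℝ)) = 0 := rfl
  rw [h2] at h1
  refine h1.congr' ?_
  filter_upwards [hIcc] with t ht
  ext x
  exact congrFun (hQ t ht) x

end TestFunctions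

section Distributions

variable {N : ℕ} {𝕜 : Type*} [RCLike 𝕜]

/-- A distribution can be differentiated along the translations of a test function. -/
theorem hasDerivAt_apply_translate (T : Distr N 𝕜) (φ : Test N) (h : E N) (t : ℝ) :
    HasDerivAt (fun t : ℝ => T (translate (t • h) φ))
      ((∂_{h} T : Distr N 𝕜) (translate (t • h) φ)) t := by
  rw [hasDerivAt_iff_tendsto_slope_zero]
  set ψ := translate (t • h) φ with hψ
  have hT : Tendsto (fun s : ℝ => T (s⁻¹ • (translate (s • h) ψ - ψ) + ∂_{h} ψ)) (𝓝[≠] 0)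
      (𝓝 0) := by
    have := ((ContinuousLinearMap.continuous T).tendsto 0).comp (tendsto_slope_translate ψ h)
    have h0 : T 0 = 0 := map_zero T
    rw [← h0]
    exact this
  have h2 : (∂_{h} T : Distr N 𝕜) ψ = 0 - T (∂_{h} ψ) := by
    rw [Distribution.lineDerivOp_apply_apply, map_neg, zero_sub]
  rw [h2]
  refine (hT.sub_const (T (∂_{h} ψ))).congr fun s => ?_
  rw [map_add, add_sub_cancel_right, map_smul, map_sub, hψ, translate_translate]
  congr 3
  rw [add_smul, add_comm]

theorem lineDeriv_comm (a b : E N) (T : Distr N 𝕜) :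
    (∂_{a} (∂_{b} T : Distr N 𝕜) : Distr N 𝕜) = ∂_{b} (∂_{a} T : Distr N 𝕜) := by
  ext φ
  simp only [Distribution.lineDerivOp_apply_apply, map_neg, neg_neg]
  congr 1
  ext x
  have h1 : ∀ v w : E N, (∂_{v} (∂_{w} φ : Test N) : Test N) x =
      fderiv ℝ (fun y => fderiv ℝ φ y w) x v := by
    intro v w
    rw [lineDeriv_test_apply]
    congr 2
  have h2 : ContDiff ℝ 2 φ := contDiff_infty.1 φ.contDiff 2
  rw [h1, h1, fderiv_fderiv_apply_comm h2, fderiv_fderiv_apply_comm h2]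
  exact (h2.contDiffAt.isSymmSndFDerivAt (by simp)) a b

end Distributions

/-! ### Iterated directional derivatives -/

section DirectionalDerivatives

variable {N : ℕ} {𝕜 : Type*} [RCLike 𝕜]

/-- The derivative of distributions along `v`, as an element of the endomorphism ring. -/
def lineDerivEnd (𝕜 : Type*) [RCLike 𝕜] (v : E N) : Module.End ℝ (Distr N 𝕜) :=
  (Distribution.lineDerivCLM v : Distr N 𝕜 →L[ℝ] Distr N 𝕜).toLinearMap

theorem lineDerivEnd_apply (v : E N) (T : Distr N 𝕜) : lineDerivEnd 𝕜 v T = ∂_{v} T := rfl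

theorem lineDerivEnd_pow_apply (v : E N) (n : ℕ) (T : Distr N 𝕜) :
    (lineDerivEnd 𝕜 v ^ n) T = (fun S : Distr N 𝕜 => ∂_{v} S)^[n] T := by
  rw [Module.End.pow_apply]
  rfl

theorem lineDerivEnd_commute (v w : E N) : Commute (lineDerivEnd 𝕜 v) (lineDerivEnd 𝕜 w) :=
  LinearMap.ext fun T => lineDeriv_comm v w T

theorem lineDerivEnd_eq_sum (h : E N) :
    lineDerivEnd 𝕜 h = ∑ i, h i • lineDerivEnd 𝕜 (EuclideanSpace.single i 1 : E N) := by
  have h1 : h = ∑ i, h i • (EuclideanSpace.single i 1 : E N) := by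
    ext j
    simp [Finset.sum_apply, Pi.single_apply]
  refine LinearMap.ext fun T => ?_
  conv_lhs => rw [h1]
  simp only [lineDerivEnd_apply, LineDeriv.lineDerivOp_left_sum, LineDeriv.lineDerivOp_left_smul,
    LinearMap.sum_apply, LinearMap.smul_apply]

/-- The multinomial expansion of `∂_h^k`. -/
theorem iterate_lineDeriv_eq_dirDeriv (k : ℕ) (h : E N) (T : Distr N 𝕜) :
    (fun S : Distr N 𝕜 => ∂_{h} S)^[k] T = dirDeriv k h T := by
  classical
  set L : Fin N → Module.End ℝ (Distr N 𝕜) :=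
    fun i => h i • lineDerivEnd 𝕜 (EuclideanSpace.single i 1 : E N) with hL
  have hcomm : ((Finset.univ : Finset (Fin N)) : Set (Fin N)).Pairwise
      (Function.onFun Commute L) := fun i _ j _ _ =>
    ((lineDerivEnd_commute _ _).smul_left _).smul_right _
  have hlist : ∀ (α : Fin N → ℕ) (l : List (Fin N)),
      ((l.map fun i => L i ^ α i).prod) T = (l.map fun i => h i ^ α i).prod •
        l.foldr (fun i T => (fun S : Distr N 𝕜 =>
          ∂_{(EuclideanSpace.single i 1 : E N)} S)^[α i] T) T := by
    intro α l
    induction l with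
    | nil => simp
    | cons a l ih =>
      rw [List.map_cons, List.prod_cons, Module.End.mul_apply, ih, map_smul, List.map_cons,
        List.prod_cons, List.foldr_cons, hL]
      simp only [smul_pow, LinearMap.smul_apply, lineDerivEnd_pow_apply]
      rw [smul_smul, mul_comm]
  rw [← lineDerivEnd_pow_apply, lineDerivEnd_eq_sum,
    Finset.sum_pow_eq_sum_piAntidiag_of_commute _ L hcomm, LinearMap.sum_apply, dirDeriv]
  refine Finset.sum_congr rfl fun α _ => ?_
  have huniv : (Finset.univ : Finset (Fin N)) = (List.finRange N).toFinset := by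
    ext i
    simp
  have h1 : Finset.noncommProd Finset.univ (fun i => L i ^ α i)
      (hcomm.mono' fun _ _ h => h.pow_pow ..) =
        ((List.finRange N).map fun i => L i ^ α i).prod := by
    rw [← Finset.noncommProd_toFinset (List.finRange N) (fun i => L i ^ α i)
      (by rw [← huniv]; exact hcomm.mono' fun _ _ h => h.pow_pow ..) (List.nodup_finRange N)]
    congr 1
  have h2 : ((List.finRange N).map fun i => h i ^ α i).prod = ∏ i, h i ^ α i := by
    rw [huniv, List.prod_toFinset _ (List.nodup_finRange N)]
  rw [h1, Module.End.mul_apply, hlist, h2, mul_smul]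
  rw [Module.End.natCast_apply, Nat.cast_smul_eq_nsmul]
  rfl

end DirectionalDerivatives

/-! ### Distributions represented by functions -/

section Represents

variable {N : ℕ} {𝕜 : Type*} [RCLike 𝕜]

theorem integrable_test_smul (φ : Test N) {g : E N → 𝕜} (hg : LocallyIntegrable g volume) :
    Integrable (fun x => φ x • g x) volume :=
  hg.integrable_smul_left_of_hasCompactSupport φ.continuous φ.hasCompactSupport

theorem Represents.congr_ae {S : Test N → 𝕜} {g g' : E N → 𝕜} (hg : Represents S g)
    (h : g =ᵐ[volume] g') : Represents S g' := by
  refine ⟨hg.1.congr h, fun φ => (hg.2 φ).trans (integral_congr_ae ?_)⟩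
  filter_upwards [h] with x hx
  rw [hx]

/-- The fundamental lemma of the calculus of variations. -/
theorem Represents.ae_eq {S : Test N → 𝕜} {g g' : E N → 𝕜} (hg : Represents S g)
    (hg' : Represents S g') : g =ᵐ[volume] g' := by
  refine ae_eq_of_integral_contDiff_smul_eq hg.1 hg'.1 fun φ hφ hφs => ?_
  let ψ : Test N := ⟨φ, hφ, hφs, fun _ _ => trivial⟩
  exact (hg.2 ψ).symm.trans (hg'.2 ψ)

theorem Represents.sum_smul {ι : Type*} (s : Finset ι) (c : ι → ℝ) {S : ι → Distr N 𝕜}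
    {g : ι → E N → 𝕜} (h : ∀ i ∈ s, Represents (S i) (g i)) :
    Represents (∑ i ∈ s, c i • S i : Distr N 𝕜) (fun x => ∑ i ∈ s, c i • g i x) := by
  constructor
  · have h1 := locallyIntegrable_finsetSum' s (f := fun i => c i • g i)
      (μ := (volume : Measure (E N))) fun i hi => ((h i hi).1.smul (c i))
    refine h1.congr (Eventually.of_forall fun x => ?_)
    simp
  · intro φ
    have h2 : (∑ i ∈ s, c i • S i : Distr N 𝕜) φ = ∑ i ∈ s, c i • S i φ := by
      classical
      induction s using Finset.induction_on with
      | empty => simp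
      | insert a s ha ih =>
        rw [Finset.sum_insert ha, Finset.sum_insert ha, ← ih fun i hi => h i (by simp [hi])]
        rfl
    rw [h2]
    simp only [Finset.smul_sum]
    rw [integral_finsetSum _ fun i hi => ?_]
    · refine Finset.sum_congr rfl fun i hi => ?_
      rw [(h i hi).2 φ, ← integral_smul]
      refine integral_congr_ae (Eventually.of_forall fun x => ?_)
      simp only
      rw [smul_comm]
    · exact integrable_test_smul φ ((h i hi).1.smul (c i))

theorem RINorm.distNorm_eq (X : RINorm N) {S : Test N → 𝕜} {g : E N → 𝕜} (hg : Represents S g) :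
    X.distNorm S = X.norm fun x => ‖g x‖ₑ := by
  refine le_antisymm (iInf₂_le g hg) (le_iInf₂ fun g' hg' => ?_)
  refine X.norm_mono _ _ hg.1.aestronglyMeasurable.enorm hg'.1.aestronglyMeasurable.enorm ?_
  filter_upwards [hg.ae_eq hg'] with x hx
  rw [hx]

theorem RINorm.gradNorm_eq (X : RINorm N) {k : ℕ} {f : Distr N 𝕜} {g : (Fin N → ℕ) → E N → 𝕜}
    (hg : ∀ α ∈ multiIndices N k, Represents (partialDeriv α f) (g α)) :
    X.gradNorm k f =
      X.norm fun x => ENNReal.ofReal (√(∑ α ∈ multiIndices N k, ‖g α x‖ ^ 2)) := by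
  have hm : ∀ g : (Fin N → ℕ) → E N → 𝕜,
      (∀ α ∈ multiIndices N k, Represents (partialDeriv α f) (g α)) →
      AEMeasurable (fun x => ENNReal.ofReal (√(∑ α ∈ multiIndices N k, ‖g α x‖ ^ 2))) volume := by
    intro g hg
    refine (Real.continuous_sqrt.measurable.comp_aemeasurable ?_).ennreal_ofReal
    exact Finset.aemeasurable_fun_sum _ fun α hα =>
      (hg α hα).1.aestronglyMeasurable.norm.aemeasurable.pow_const 2
  refine le_antisymm (iInf₂_le g hg) (le_iInf₂ fun g' hg' => ?_)
  refine X.norm_mono _ _ (hm g hg) (hm g' hg') ?_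
  have h1 : ∀ᵐ x ∂(volume : Measure (E N)), ∀ α ∈ multiIndices N k, g α x = g' α x :=
    (Finset.eventually_all _).2 fun α hα => (hg α hα).ae_eq (hg' α hα)
  filter_upwards [h1] with x hx
  rw [Finset.sum_congr rfl fun α hα => by rw [hx α hα]]

theorem mem_multiIndices {k : ℕ} {α : Fin N → ℕ} : α ∈ multiIndices N k ↔ ∑ i, α i = k := by
  simp [multiIndices, Finset.mem_piAntidiag]

/-- The derivatives of order `k` of an element of `Ẇ^k X` are given by strongly measurable functions
in `X`. -/
theorem RINorm.exists_represents_of_mem_homSobolev (X : RINorm N) {k : ℕ} {f : Distr N 𝕜}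
    (hf : f ∈ X.homSobolev k 𝕜) :
    ∃ g : (Fin N → ℕ) → E N → 𝕜, (∀ α, StronglyMeasurable (g α)) ∧
      ∀ α ∈ multiIndices N k, Represents (partialDeriv α f) (g α) ∧
        X.norm (fun x => ‖g α x‖ₑ) < ∞ := by
  have h1 : ∀ α : Fin N → ℕ, ∃ g : E N → 𝕜, StronglyMeasurable g ∧ (α ∈ multiIndices N k →
      Represents (partialDeriv α f) g ∧ X.norm (fun x => ‖g x‖ₑ) < ∞) := by
    intro α
    by_cases hα : α ∈ multiIndices N k
    · obtain ⟨g, hg, hgX⟩ := hf α (mem_multiIndices.1 hα)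
      have hgm := hg.1.aestronglyMeasurable
      refine ⟨hgm.mk g, hgm.stronglyMeasurable_mk, fun _ => ⟨hg.congr_ae hgm.ae_eq_mk, ?_⟩⟩
      rw [← X.distNorm_eq (hg.congr_ae hgm.ae_eq_mk), X.distNorm_eq hg]
      exact hgX
    · exact ⟨0, stronglyMeasurable_zero, fun h => absurd h hα⟩
  choose g hg hg' using h1
  exact ⟨g, hg, hg'⟩

end Represents

/-! ### The Peano kernel of the `k`-th difference -/

/-- The distribution of the sum of `k` independent variables that are uniform on `[0, 1]`. -/
def peanoMeasure : ℕ → Measure ℝ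
  | 0 => Measure.dirac 0
  | k + 1 => ((peanoMeasure k).prod (volume.restrict (Set.Ioc 0 1))).map fun q => q.1 + q.2

instance isProbabilityMeasure_peanoMeasure (k : ℕ) : IsProbabilityMeasure (peanoMeasure k) := by
  induction k with
  | zero => rw [peanoMeasure]; infer_instance
  | succ k ih =>
    have : IsProbabilityMeasure ((volume : Measure ℝ).restrict (Set.Ioc 0 1)) := ⟨by simp⟩
    exact Measure.isProbabilityMeasure_map (by fun_prop)

theorem ae_mem_Icc_peanoMeasure (k : ℕ) : ∀ᵐ s ∂peanoMeasure k, s ∈ Set.Icc (0 : ℝ) k := by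
  induction k with
  | zero => simp [peanoMeasure, ae_dirac_eq]
  | succ k ih =>
    rw [peanoMeasure, ae_map_iff (f := fun q : ℝ × ℝ => q.1 + q.2)
      (measurable_fst.add measurable_snd).aemeasurable
      (p := fun s => s ∈ Set.Icc (0 : ℝ) (k + 1 : ℕ)) measurableSet_Icc]
    have h1 : ∀ᵐ q ∂(peanoMeasure k).prod ((volume : Measure ℝ).restrict (Set.Ioc 0 1)),
        q.1 ∈ Set.Icc (0 : ℝ) k := Measure.quasiMeasurePreserving_fst.ae ih
    have h2 : ∀ᵐ q ∂(peanoMeasure k).prod ((volume : Measure ℝ).restrict (Set.Ioc 0 1)),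
        q.2 ∈ Set.Ioc (0 : ℝ) 1 :=
      Measure.quasiMeasurePreserving_snd.ae (ae_restrict_mem measurableSet_Ioc)
    filter_upwards [h1, h2] with q hq1 hq2
    push_cast
    exact ⟨by linarith [hq1.1, hq2.1], by linarith [hq1.2, hq2.2]⟩

theorem integrable_peanoMeasure {F : Type*} [NormedAddCommGroup F] (k : ℕ) {D : ℝ → F}
    (hD : Continuous D) : Integrable D (peanoMeasure k) := by
  have h1 : (peanoMeasure k).restrict (Set.Icc 0 k) = peanoMeasure k :=
    Measure.restrict_eq_self_of_ae_mem (ae_mem_Icc_peanoMeasure k)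
  rw [← h1]
  exact hD.continuousOn.integrableOn_compact isCompact_Icc

/-- Peano's formula: the `k`-th difference is an average of the `k`-th derivative. -/
theorem iterate_fwdDiff_eq_integral {F : Type*} [NormedAddCommGroup F] [NormedSpace ℝ F]
    [CompleteSpace F] {D : ℕ → ℝ → F} (hD : ∀ i t, HasDerivAt (D i) (D (i + 1) t) t)
    (k : ℕ) (t : ℝ) :
    (fwdDiff 1)^[k] (D 0) t = ∫ s, D k (t + s) ∂peanoMeasure k := by
  have hc : ∀ i, Continuous (D i) := fun i =>
    continuous_iff_continuousAt.2 fun t => (hD i t).continuousAt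
  induction k generalizing t with
  | zero => simp [peanoMeasure]
  | succ k ih =>
    have hprod : Integrable (fun q : ℝ × ℝ => D (k + 1) (t + (q.1 + q.2)))
        ((peanoMeasure k).prod (volume.restrict (Set.Ioc 0 1))) := by
      have h1 : Integrable (fun s => D (k + 1) (t + s)) (peanoMeasure (k + 1)) :=
        integrable_peanoMeasure _ ((hc _).comp (by fun_prop))
      rw [peanoMeasure] at h1
      exact h1.comp_measurable (by fun_prop)
    have hi : ∀ u, Integrable (fun s => D k (u + s)) (peanoMeasure k) := fun u =>
      integrable_peanoMeasure _ ((hc _).comp (by fun_prop))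
    rw [Function.iterate_succ_apply', fwdDiff, ih, ih, ← integral_sub (hi _) (hi _),
      peanoMeasure, integral_map (φ := fun q : ℝ × ℝ => q.1 + q.2)
        (f := fun s => D (k + 1) (t + s)) (measurable_fst.add measurable_snd).aemeasurable
        ((hc _).comp (continuous_const.add continuous_id)).aestronglyMeasurable,
      integral_prod _ hprod]
    refine integral_congr_ae (Eventually.of_forall fun s => ?_)
    simp only
    rw [← intervalIntegral.integral_of_le zero_le_one,
      intervalIntegral.integral_eq_sub_of_hasDerivAt (f := fun u => D k (t + (s + u)))]
    · simp only [add_zero]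
      congr 2
      ring
    · intro u _
      have h2 : HasDerivAt (fun u => t + (s + u)) 1 u := by
        simpa [add_assoc] using ((hasDerivAt_id u).const_add (t + s))
      simpa [Function.comp_def] using (hD k (t + (s + u))).scomp u h2
    · exact ((hc _).comp (by fun_prop)).intervalIntegrable _ _

/-! ### Segment averages -/

section SegmentAverages

variable {N : ℕ} {𝕜 : Type*} [RCLike 𝕜]

/-- The average of the translates `G (· + s h)`, `0 ≤ s ≤ k`, with respect to the Peano kernel. -/
def segmentAverage (k : ℕ) (h : E N) (G : E N → 𝕜) (x : E N) : 𝕜 :=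
  ∫ s, G (x + s • h) ∂peanoMeasure k

theorem stronglyMeasurable_segmentAverage (k : ℕ) (h : E N) {G : E N → 𝕜}
    (hG : StronglyMeasurable G) : StronglyMeasurable (segmentAverage k h G) :=
  stronglyMeasurable_average hG (by fun_prop)

/-- In a ball, a segment average only depends on the values in a larger ball. -/
theorem translate_indicator_eq {k : ℕ} {s : ℝ} (hs : s ∈ Set.Icc (0 : ℝ) k) {R H : ℝ} {h : E N}
    (hh : ‖h‖ ≤ H) (G : E N → 𝕜) {x : E N} (hx : x ∈ Metric.ball (0 : E N) R) :
    (Metric.ball (0 : E N) (R + k * H)).indicator G (x + s • h) = G (x + s • h) := by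
  rw [Set.indicator_of_mem]
  rw [mem_ball_zero_iff] at hx ⊢
  calc ‖x + s • h‖ ≤ ‖x‖ + ‖s • h‖ := norm_add_le _ _
    _ = ‖x‖ + s * ‖h‖ := by rw [norm_smul, Real.norm_eq_abs, abs_of_nonneg hs.1]
    _ < R + k * H := add_lt_add_of_lt_of_le hx
      (mul_le_mul hs.2 hh (norm_nonneg _) (Nat.cast_nonneg _))

theorem segmentAverage_indicator (k : ℕ) {R H : ℝ} {h : E N} (hh : ‖h‖ ≤ H) (G : E N → 𝕜)
    {x : E N} (hx : x ∈ Metric.ball (0 : E N) R) :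
    segmentAverage k h ((Metric.ball (0 : E N) (R + k * H)).indicator G) x =
      segmentAverage k h G x :=
  integral_congr_ae ((ae_mem_Icc_peanoMeasure k).mono fun _ hs => translate_indicator_eq hs hh G hx)

theorem integrable_indicator_ball {G : E N → 𝕜} (hG : LocallyIntegrable G volume) (R : ℝ) :
    Integrable ((Metric.ball (0 : E N) R).indicator G) volume := by
  rw [integrable_indicator_iff measurableSet_ball]
  exact (hG.integrableOn_isCompact (isCompact_closedBall 0 R)).mono_set
    Metric.ball_subset_closedBall

theorem locallyIntegrable_segmentAverage (k : ℕ) (h : E N) {G : E N → 𝕜}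
    (hGm : StronglyMeasurable G) (hG : LocallyIntegrable G volume) :
    LocallyIntegrable (segmentAverage k h G) volume := by
  intro x
  refine ⟨Metric.ball 0 (‖x‖ + 1), Metric.isOpen_ball.mem_nhds (by simp), ?_⟩
  have h1 := (integrable_translate_prod (μ := peanoMeasure k)
    (hGm.indicator measurableSet_ball) (integrable_indicator_ball hG (‖x‖ + 1 + k * ‖h‖))
    (Y := fun s => s • h) (by fun_prop)).integral_prod_left
  refine h1.integrableOn.congr_fun (fun y hy => ?_) measurableSet_ball
  exact segmentAverage_indicator k le_rfl G hy

/-- If `∂_h^k f` is a function, then `Δ_h^k f` is a segment average of it. This is Peano's formula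
for the smooth function `t ↦ ⟨f(· + t h), φ⟩`, whose `i`-th derivative is
`t ↦ ⟨(∂_h^i f)(· + t h), φ⟩`. -/
theorem represents_diff {k : ℕ} {h : E N} {f : Distr N 𝕜} {G : E N → 𝕜}
    (hGm : StronglyMeasurable G) (hG : Represents (dirDeriv k h f) G) :
    Represents (diff k h f) (segmentAverage k h G) := by
  refine ⟨locallyIntegrable_segmentAverage k h hGm hG.1, fun φ => ?_⟩
  let D : ℕ → ℝ → 𝕜 := fun i t =>
    ((fun S : Distr N 𝕜 => ∂_{h} S)^[i] f) (translate (t • h) φ)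
  have hD : ∀ i t, HasDerivAt (D i) (D (i + 1) t) t := by
    intro i t
    have h1 := hasDerivAt_apply_translate ((fun S : Distr N 𝕜 => ∂_{h} S)^[i] f) φ h t
    simp only [D, Function.iterate_succ_apply']
    exact h1
  have h1 : diff k h f φ = (fwdDiff 1)^[k] (D 0) 0 := by
    rw [fwdDiff_iter_eq_sum_shift, diff]
    refine Finset.sum_congr rfl fun j hj => ?_
    have hjk : j ≤ k := Nat.lt_succ_iff.1 (Finset.mem_range.1 hj)
    have h2 : ((-1 : ℤ) ^ (k - j)) = (-1) ^ (j + k) := by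
      rw [show j + k = (k - j) + 2 * j by omega, pow_add, pow_mul]
      simp
    rw [h2, ← Int.cast_smul_eq_zsmul ℝ]
    push_cast
    congr 1
    simp [D]
  have h2 : ∀ s, D k (0 + s) = ∫ x, φ x • G (x + s • h) := by
    intro s
    simp only [D, zero_add]
    rw [iterate_lineDeriv_eq_dirDeriv, hG.2,
      ← integral_add_right_eq_self (fun x => translate (s • h) φ x • G x) (s • h)]
    simp [translate_apply]
  rw [h1, iterate_fwdDiff_eq_integral hD]
  simp only [h2]
  -- Inside a ball containing the support of `φ` one may replace `G` by an integrable function.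
  obtain ⟨R, hR⟩ := φ.hasCompactSupport.isBounded.subset_ball (0 : E N)
  set G' : E N → 𝕜 := (Metric.ball (0 : E N) (R + k * ‖h‖)).indicator G with hG'
  have hprod : Integrable (fun q : E N × ℝ => φ q.1 • G' (q.1 + q.2 • h))
      (volume.prod (peanoMeasure k)) := by
    obtain ⟨C, hC⟩ := φ.continuous.bounded_above_of_compact_support φ.hasCompactSupport
    exact (integrable_translate_prod (Y := fun s : ℝ => s • h) (hGm.indicator measurableSet_ball)
      (integrable_indicator_ball hG.1 _) (by fun_prop)).bdd_smul C
      (φ.continuous.comp continuous_fst).aestronglyMeasurable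
      (Eventually.of_forall fun q => hC q.1)
  have h3 : ∀ᵐ s ∂peanoMeasure k, ∀ x, φ x • G (x + s • h) = φ x • G' (x + s • h) := by
    filter_upwards [ae_mem_Icc_peanoMeasure k] with s hs x
    by_cases hx : x ∈ tsupport φ
    · rw [hG', translate_indicator_eq hs le_rfl G (hR hx)]
    · simp [image_eq_zero_of_notMem_tsupport hx]
  have h4 : ∀ᵐ s ∂peanoMeasure k, ∫ x, φ x • G (x + s • h) = ∫ x, φ x • G' (x + s • h) :=
    h3.mono fun s hs => by simp only [hs]
  rw [integral_congr_ae h4, ← integral_integral_swap hprod]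
  refine integral_congr_ae (Eventually.of_forall fun x => ?_)
  simp only
  rw [← integral_congr_ae (h3.mono fun s hs => hs x), integral_smul]
  rfl

/-- Segment averages of a locally integrable function depend continuously, in `L¹` of balls, on
the direction. -/
theorem tendsto_lintegral_segmentAverage_sub (k : ℕ) {G : E N → 𝕜} (hGm : StronglyMeasurable G)
    (hG : LocallyIntegrable G volume) {h : ℕ → E N} {h₀ : E N} (hh : Tendsto h atTop (𝓝 h₀))
    (R : ℝ) :
    Tendsto (fun n => ∫⁻ x in Metric.ball 0 R,
      ‖segmentAverage k (h n) G x - segmentAverage k h₀ G x‖ₑ) atTop (𝓝 0) := by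
  obtain ⟨H, hH⟩ := (Metric.isBounded_range_of_tendsto h hh).exists_norm_le
  have hH' : ∀ n, ‖h n‖ ≤ H := fun n => hH _ ⟨n, rfl⟩
  have hH₀ : ‖h₀‖ ≤ H := le_of_tendsto' hh.norm hH'
  have h1 := tendsto_lintegral_average_sub (μ := peanoMeasure k)
    (hGm.indicator (measurableSet_ball (x := (0 : E N)) (ε := R + k * H)))
    (integrable_indicator_ball hG _) (Y := fun n s => s • h n) (Z := fun s => s • h₀)
    (fun n => by fun_prop) (by fun_prop) (fun s => hh.const_smul s)
  refine tendsto_of_tendsto_of_tendsto_of_le_of_le tendsto_const_nhds h1 (fun _ => zero_le)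
    fun n => ?_
  refine (lintegral_mono_ae ?_).trans (setLIntegral_le_lintegral (Metric.ball 0 R) _)
  filter_upwards [ae_restrict_mem measurableSet_ball] with x hx
  rw [← segmentAverage_indicator k (hH' n) G hx, ← segmentAverage_indicator k hH₀ G hx]
  rfl

end SegmentAverages

/-! ### Norms of segment averages of the directional derivatives -/

section SegmentNorm

variable {N : ℕ} {𝕜 : Type*} [RCLike 𝕜]

/-- The coefficient `(k!/α!) y^α` of `∂^α` in `∂_y^k`. -/
def dirCoeff (α : Fin N → ℕ) (y : E N) : ℝ := (Nat.multinomial Finset.univ α : ℝ) * ∏ i, y i ^ α i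

/-- The function `∑_{|α|=k} (k!/α!) y^α g_α`, which is `∂_y^k f` if `g_α = ∂^α f`. -/
def dirSum (k : ℕ) (g : (Fin N → ℕ) → E N → 𝕜) (y x : E N) : 𝕜 :=
  ∑ α ∈ multiIndices N k, dirCoeff α y • g α x

theorem continuous_dirCoeff (α : Fin N → ℕ) : Continuous (dirCoeff α) := by
  unfold dirCoeff
  fun_prop

theorem dirCoeff_smul {k : ℕ} {α : Fin N → ℕ} (hα : α ∈ multiIndices N k) (r : ℝ) (y : E N) :
    dirCoeff α (r • y) = r ^ k * dirCoeff α y := by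
  rw [dirCoeff, dirCoeff, ← mem_multiIndices.1 hα, ← Finset.prod_pow_eq_pow_sum, mul_left_comm,
    ← Finset.prod_mul_distrib]
  simp [mul_pow]

theorem dirSum_smul (k : ℕ) (g : (Fin N → ℕ) → E N → 𝕜) (r : ℝ) (y x : E N) :
    dirSum k g (r • y) x = r ^ k • dirSum k g y x := by
  rw [dirSum, dirSum, Finset.smul_sum]
  refine Finset.sum_congr rfl fun α hα => ?_
  rw [dirCoeff_smul hα, mul_smul]

theorem represents_dirDeriv {k : ℕ} {f : Distr N 𝕜} {g : (Fin N → ℕ) → E N → 𝕜}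
    (hg : ∀ α ∈ multiIndices N k, Represents (partialDeriv α f) (g α)) (y : E N) :
    Represents (dirDeriv k y f) (dirSum k g y) :=
  Represents.sum_smul _ _ hg

theorem stronglyMeasurable_dirSum (k : ℕ) {g : (Fin N → ℕ) → E N → 𝕜}
    (hg : ∀ α, StronglyMeasurable (g α)) (y : E N) : StronglyMeasurable (dirSum k g y) :=
  Finset.stronglyMeasurable_fun_sum _ fun α _ => (hg α).const_smul _

/-- A segment average is defined by a convergent integral at almost every point. -/
theorem ae_integrable_translate (k : ℕ) (h : E N) {G : E N → 𝕜} (hGm : StronglyMeasurable G)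
    (hG : LocallyIntegrable G volume) :
    ∀ᵐ x ∂(volume : Measure (E N)), Integrable (fun s => G (x + s • h)) (peanoMeasure k) := by
  have h1 : ∀ n : ℕ, ∀ᵐ x ∂(volume : Measure (E N)), Integrable (fun s =>
      (Metric.ball (0 : E N) (n + k * ‖h‖)).indicator G (x + s • h)) (peanoMeasure k) := fun n =>
    (integrable_translate_prod (μ := peanoMeasure k) (Y := fun s => s • h)
      (hGm.indicator measurableSet_ball) (integrable_indicator_ball hG (n + k * ‖h‖))
      (by fun_prop)).prod_right_ae
  filter_upwards [ae_all_iff.2 h1] with x hx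
  obtain ⟨n, hn⟩ := exists_nat_gt ‖x‖
  refine (hx n).congr ?_
  filter_upwards [ae_mem_Icc_peanoMeasure k] with s hs
  exact translate_indicator_eq hs le_rfl G (by simpa using hn)

theorem segmentAverage_dirSum_ae (k : ℕ) (h y : E N) {g : (Fin N → ℕ) → E N → 𝕜}
    (hgm : ∀ α, StronglyMeasurable (g α))
    (hg : ∀ α ∈ multiIndices N k, LocallyIntegrable (g α) volume) :
    ∀ᵐ x ∂(volume : Measure (E N)), segmentAverage k h (dirSum k g y) x =
      ∑ α ∈ multiIndices N k, dirCoeff α y • segmentAverage k h (g α) x := by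
  have h1 : ∀ᵐ x ∂(volume : Measure (E N)), ∀ α ∈ multiIndices N k,
      Integrable (fun s => g α (x + s • h)) (peanoMeasure k) :=
    (Finset.eventually_all _).2 fun α hα => ae_integrable_translate k h (hgm α) (hg α hα)
  filter_upwards [h1] with x hx
  simp only [segmentAverage, dirSum]
  rw [integral_finsetSum (f := fun α s => dirCoeff α y • g α (x + s • h)) _
    fun α hα => (hx α hα).smul (dirCoeff α y)]
  simp only [integral_smul]

/-- The norm of the average of the translates `(∂_y^k f) (· + s r y)`, `0 ≤ s ≤ k`, where
`g α = ∂^α f`. For `r > 0` this is `r^{-k} ‖Δ_{r y}^k f‖_X`; for `r = 0` it is `‖∂_y^k f‖_X`. -/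
def RINorm.segNorm (X : RINorm N) (k : ℕ) (g : (Fin N → ℕ) → E N → 𝕜) (r : ℝ) (y : E N) : ℝ≥0∞ :=
  X.norm fun x => ‖segmentAverage k (r • y) (dirSum k g y) x‖ₑ

variable (X : RINorm N) {k : ℕ} {g : (Fin N → ℕ) → E N → 𝕜}

theorem RINorm.segNorm_zero (y : E N) :
    X.segNorm k g 0 y = X.norm fun x => ‖dirSum k g y x‖ₑ := by
  simp [RINorm.segNorm, segmentAverage]

theorem RINorm.segNorm_le_segNorm_zero (hgm : ∀ α, StronglyMeasurable (g α)) (r : ℝ) (y : E N) :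
    X.segNorm k g r y ≤ X.segNorm k g 0 y := by
  have h1 := stronglyMeasurable_dirSum k hgm y
  have h2 : Measurable fun x => ∫⁻ s, ‖dirSum k g y (x + s • r • y)‖ₑ ∂peanoMeasure k := by
    have : Measurable fun q : E N × ℝ => ‖dirSum k g y (q.1 + q.2 • r • y)‖ₑ :=
      h1.enorm.comp (by fun_prop)
    exact this.lintegral_prod_right'
  rw [X.segNorm_zero]
  refine le_trans ?_ (X.norm_lintegral_translate_le (μ := peanoMeasure k)
    (Y := fun s => s • r • y) h1.enorm (by fun_prop))
  exact X.norm_mono _ _ (stronglyMeasurable_segmentAverage k _ h1).enorm.aemeasurable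
    h2.aemeasurable (Eventually.of_forall fun x => enorm_integral_le_lintegral_enorm _)

theorem RINorm.segNorm_zero_smul (hgm : ∀ α, StronglyMeasurable (g α)) (r : ℝ) (y : E N) :
    X.segNorm k g 0 (r • y) = ‖r ^ k‖ₑ * X.segNorm k g 0 y := by
  rw [X.segNorm_zero, X.segNorm_zero]
  refine Eq.trans ?_ (X.norm_mul ‖r ^ k‖₊ _
    (stronglyMeasurable_dirSum k hgm y).enorm.aemeasurable)
  simp only [dirSum_smul, enorm_smul]
  rfl

theorem RINorm.distNorm_dirDeriv {f : Distr N 𝕜}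
    (hg : ∀ α ∈ multiIndices N k, Represents (partialDeriv α f) (g α)) (y : E N) :
    X.distNorm (dirDeriv k y f) = X.segNorm k g 0 y := by
  rw [X.segNorm_zero, X.distNorm_eq (represents_dirDeriv hg y)]

theorem RINorm.distNorm_diff {f : Distr N 𝕜} (hgm : ∀ α, StronglyMeasurable (g α))
    (hg : ∀ α ∈ multiIndices N k, Represents (partialDeriv α f) (g α)) (r : ℝ) (y : E N) :
    X.distNorm (diff k (r • y) f) = ‖r ^ k‖ₑ * X.segNorm k g r y := by
  rw [X.distNorm_eq (represents_diff (stronglyMeasurable_dirSum k hgm (r • y))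
    (represents_dirDeriv hg (r • y)))]
  refine Eq.trans ?_ (X.norm_mul ‖r ^ k‖₊ _ (stronglyMeasurable_segmentAverage k _
    (stronglyMeasurable_dirSum k hgm y)).enorm.aemeasurable)
  congr 1
  ext x
  simp only [segmentAverage, dirSum_smul, integral_smul, enorm_smul]
  rfl

/-- Lower semicontinuity: segment averages depend continuously in `L¹` of balls on the segment, and
sublevel sets of the norm are closed in that topology. -/
theorem RINorm.lowerSemicontinuous_segNorm (hgm : ∀ α, StronglyMeasurable (g α))
    (hg : ∀ α ∈ multiIndices N k, LocallyIntegrable (g α) volume) :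
    LowerSemicontinuous fun q : ℝ × E N => X.segNorm k g q.1 q.2 := by
  rw [lowerSemicontinuous_iff_isClosed_preimage]
  -- It remains to show that the averages along a convergent sequence converge in `L¹` of balls.
  refine fun c => IsSeqClosed.isClosed fun q q₀ hq hlim => ?_
  have hr : Tendsto (fun n => (q n).1 • (q n).2) atTop (𝓝 (q₀.1 • q₀.2)) :=
    (continuous_fst.smul continuous_snd).continuousAt.tendsto.comp hlim
  have hy : Tendsto (fun n => (q n).2) atTop (𝓝 q₀.2) :=
    continuous_snd.continuousAt.tendsto.comp hlim
  refine X.norm_le_of_tendsto_lintegral (c := c)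
    (fun n => (stronglyMeasurable_segmentAverage k _
      (stronglyMeasurable_dirSum k hgm (q n).2)).aestronglyMeasurable)
    (stronglyMeasurable_segmentAverage k _
      (stronglyMeasurable_dirSum k hgm q₀.2)).aestronglyMeasurable (fun R => ?_) hq
  have hbound : ∀ n, ∫⁻ x in Metric.ball 0 R,
      ‖segmentAverage k ((q n).1 • (q n).2) (dirSum k g (q n).2) x -
        segmentAverage k (q₀.1 • q₀.2) (dirSum k g q₀.2) x‖ₑ ≤
      ∑ α ∈ multiIndices N k, (‖dirCoeff α (q n).2‖ₑ * (∫⁻ x in Metric.ball 0 R,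
          ‖segmentAverage k ((q n).1 • (q n).2) (g α) x -
            segmentAverage k (q₀.1 • q₀.2) (g α) x‖ₑ) +
        ‖dirCoeff α (q n).2 - dirCoeff α q₀.2‖ₑ * ∫⁻ x in Metric.ball 0 R,
          ‖segmentAverage k (q₀.1 • q₀.2) (g α) x‖ₑ) := by
    intro n
    have hm : ∀ h α, StronglyMeasurable (segmentAverage k h (g α)) := fun h α =>
      stronglyMeasurable_segmentAverage k h (hgm α)
    have h1 : ∑ α ∈ multiIndices N k, (‖dirCoeff α (q n).2‖ₑ * (∫⁻ x in Metric.ball 0 R,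
          ‖segmentAverage k ((q n).1 • (q n).2) (g α) x -
            segmentAverage k (q₀.1 • q₀.2) (g α) x‖ₑ) +
        ‖dirCoeff α (q n).2 - dirCoeff α q₀.2‖ₑ * ∫⁻ x in Metric.ball 0 R,
          ‖segmentAverage k (q₀.1 • q₀.2) (g α) x‖ₑ) =
        ∫⁻ x in Metric.ball 0 R, ∑ α ∈ multiIndices N k, (‖dirCoeff α (q n).2‖ₑ *
          ‖segmentAverage k ((q n).1 • (q n).2) (g α) x -
            segmentAverage k (q₀.1 • q₀.2) (g α) x‖ₑ +
        ‖dirCoeff α (q n).2 - dirCoeff α q₀.2‖ₑ *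
          ‖segmentAverage k (q₀.1 • q₀.2) (g α) x‖ₑ) := by
      have hm1 : ∀ α, Measurable fun x => ‖segmentAverage k ((q n).1 • (q n).2) (g α) x -
            segmentAverage k (q₀.1 • q₀.2) (g α) x‖ₑ := fun α =>
        ((hm _ α).sub (hm _ α)).enorm
      have hm2 : ∀ α, Measurable fun x => ‖segmentAverage k (q₀.1 • q₀.2) (g α) x‖ₑ := fun α =>
        (hm _ α).enorm
      rw [lintegral_finsetSum (f := fun α x => ‖dirCoeff α (q n).2‖ₑ *
          ‖segmentAverage k ((q n).1 • (q n).2) (g α) x -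
            segmentAverage k (q₀.1 • q₀.2) (g α) x‖ₑ +
        ‖dirCoeff α (q n).2 - dirCoeff α q₀.2‖ₑ *
          ‖segmentAverage k (q₀.1 • q₀.2) (g α) x‖ₑ) _ fun α _ =>
        ((hm1 α).const_mul _).add ((hm2 α).const_mul _)]
      refine Finset.sum_congr rfl fun α _ => ?_
      rw [lintegral_add_left ((hm1 α).const_mul _), lintegral_const_mul _ (hm1 α),
        lintegral_const_mul _ (hm2 α)]
    rw [h1]
    refine lintegral_mono_ae (ae_restrict_of_ae ?_)
    filter_upwards [segmentAverage_dirSum_ae k ((q n).1 • (q n).2) (q n).2 hgm hg,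
      segmentAverage_dirSum_ae k (q₀.1 • q₀.2) q₀.2 hgm hg] with x hx1 hx2
    rw [hx1, hx2, ← Finset.sum_sub_distrib]
    refine (enorm_sum_le _ _).trans (Finset.sum_le_sum fun α _ => ?_)
    rw [← enorm_smul, ← enorm_smul]
    refine le_trans (le_of_eq ?_) (enorm_add_le _ _)
    rw [smul_sub, sub_smul]
    congr 1
    abel
  refine tendsto_of_tendsto_of_tendsto_of_le_of_le tendsto_const_nhds ?_ (fun _ => zero_le) hbound
  have hzero : (0 : ℝ≥0∞) = ∑ α ∈ multiIndices N k, 0 := Finset.sum_const_zero.symm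
  rw [hzero]
  refine tendsto_finsetSum _ fun α hα => ?_
  have hc : Tendsto (fun n => dirCoeff α (q n).2) atTop (𝓝 (dirCoeff α q₀.2)) :=
    ((continuous_dirCoeff α).tendsto _).comp hy
  have hfin : ∫⁻ x in Metric.ball 0 R, ‖segmentAverage k (q₀.1 • q₀.2) (g α) x‖ₑ ≠ ∞ := by
    have h2 := (locallyIntegrable_segmentAverage k (q₀.1 • q₀.2) (hgm α)
      (hg α hα)).integrableOn_isCompact (isCompact_closedBall 0 (R : ℝ))
    exact ((h2.mono_set Metric.ball_subset_closedBall).2).ne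
  have h3 := ENNReal.Tendsto.mul hc.enorm (Or.inr ENNReal.zero_ne_top)
    (tendsto_lintegral_segmentAverage_sub k (hgm α) (hg α hα) hr R) (Or.inr (by simp))
  have h4 : Tendsto (fun n => ‖dirCoeff α (q n).2 - dirCoeff α q₀.2‖ₑ) atTop (𝓝 0) := by
    simpa using (hc.sub_const (dirCoeff α q₀.2)).enorm
  have h5 := ENNReal.Tendsto.mul_const h4 (Or.inr hfin)
  simpa using h3.add h5

/-- `‖∇^k f‖_X` in terms of `g α = ∂^α f`. -/
def RINorm.fullNorm (X : RINorm N) (k : ℕ) (g : (Fin N → ℕ) → E N → 𝕜) : ℝ≥0∞ :=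
  X.norm fun x => ENNReal.ofReal (√(∑ α ∈ multiIndices N k, ‖g α x‖ ^ 2))

theorem measurable_fullNorm (k : ℕ) (hgm : ∀ α, StronglyMeasurable (g α)) :
    Measurable fun x => ENNReal.ofReal (√(∑ α ∈ multiIndices N k, ‖g α x‖ ^ 2)) :=
  (Real.continuous_sqrt.measurable.comp (Finset.measurable_fun_sum _ fun α _ =>
    (hgm α).norm.measurable.pow_const 2)).ennreal_ofReal

theorem enorm_le_ofReal_sqrt_sum {α : Fin N → ℕ} (hα : α ∈ multiIndices N k) (x : E N) :
    ‖g α x‖ₑ ≤ ENNReal.ofReal (√(∑ α ∈ multiIndices N k, ‖g α x‖ ^ 2)) := by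
  rw [← ofReal_norm]
  refine ENNReal.ofReal_le_ofReal (Real.le_sqrt_of_sq_le ?_)
  exact Finset.single_le_sum (f := fun α => ‖g α x‖ ^ 2) (fun _ _ => by positivity) hα

theorem ofReal_sqrt_sum_le (x : E N) :
    ENNReal.ofReal (√(∑ α ∈ multiIndices N k, ‖g α x‖ ^ 2)) ≤
      ∑ α ∈ multiIndices N k, ‖g α x‖ₑ := by
  have h1 : √(∑ α ∈ multiIndices N k, ‖g α x‖ ^ 2) ≤ ∑ α ∈ multiIndices N k, ‖g α x‖ := by
    refine Real.sqrt_le_iff.2 ⟨by positivity, ?_⟩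
    exact Finset.sum_sq_le_sq_sum_of_nonneg fun _ _ => norm_nonneg _
  refine (ENNReal.ofReal_le_ofReal h1).trans ?_
  rw [ENNReal.ofReal_sum_of_nonneg fun _ _ => norm_nonneg _]
  simp only [ofReal_norm, le_refl]

theorem RINorm.norm_sum_smul_le_fullNorm (hgm : ∀ α, StronglyMeasurable (g α))
    (c : (Fin N → ℕ) → ℝ) :
    X.norm (fun x => ‖∑ α ∈ multiIndices N k, c α • g α x‖ₑ) ≤
      (∑ α ∈ multiIndices N k, ‖c α‖ₑ) * X.fullNorm k g := by
  have h1 : (∑ α ∈ multiIndices N k, ‖c α‖ₑ) =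
      ((∑ α ∈ multiIndices N k, ‖c α‖₊ : ℝ≥0) : ℝ≥0∞) := by
    push_cast
    rfl
  rw [h1, RINorm.fullNorm, ← X.norm_mul _ _ (measurable_fullNorm k hgm).aemeasurable, ← h1]
  refine X.norm_mono _ _ ?_ ?_ (Eventually.of_forall fun x => ?_)
  · exact (Finset.stronglyMeasurable_fun_sum _ fun α _ =>
      (hgm α).const_smul (c α)).enorm.aemeasurable
  · exact ((measurable_fullNorm k hgm).const_mul _).aemeasurable
  · refine (enorm_sum_le _ _).trans ?_
    simp only [enorm_smul, Finset.sum_mul]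
    exact Finset.sum_le_sum fun α hα => mul_le_mul_right (enorm_le_ofReal_sqrt_sum hα x) _

theorem RINorm.fullNorm_le_sum (hgm : ∀ α, StronglyMeasurable (g α)) :
    X.fullNorm k g ≤ ∑ α ∈ multiIndices N k, X.norm fun x => ‖g α x‖ₑ := by
  refine le_trans ?_ (X.norm_sum_le _ _ fun α _ => (hgm α).enorm.aemeasurable)
  exact X.norm_mono _ _ (measurable_fullNorm k hgm).aemeasurable
    (Finset.measurable_fun_sum _ fun α _ => (hgm α).enorm).aemeasurable
    (Eventually.of_forall ofReal_sqrt_sum_le)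

end SegmentNorm

/-! ### Coercivity of the directional derivatives -/

section Coercivity

variable {N : ℕ}

/-- A form `∑_{|α|=k} c_α (k!/α!) y^α` that vanishes on the unit ball is zero. -/
theorem eq_zero_of_forall_sum_mul_dirCoeff {k : ℕ} {c : (Fin N → ℕ) → ℝ}
    (h : ∀ y : E N, ‖y‖ < 1 → ∑ α ∈ multiIndices N k, c α * dirCoeff α y = 0) :
    ∀ α ∈ multiIndices N k, c α = 0 := by
  classical
  have hall : ∀ y : E N, ∑ α ∈ multiIndices N k, c α * dirCoeff α y = 0 := by
    intro y
    set t : ℝ := (‖y‖ + 1)⁻¹ with ht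
    have htpos : 0 < t := by positivity
    have h1 : ‖t • y‖ < 1 := by
      rw [norm_smul, Real.norm_eq_abs, abs_of_pos htpos, ht, inv_mul_lt_iff₀ (by positivity)]
      linarith
    have h2 := h _ h1
    rw [Finset.sum_congr rfl fun α hα => by
      rw [dirCoeff_smul hα, mul_left_comm], ← Finset.mul_sum] at h2
    exact (mul_eq_zero.1 h2).resolve_left (pow_ne_zero _ htpos.ne')
  let P : MvPolynomial (Fin N) ℝ := ∑ α ∈ multiIndices N k,
    MvPolynomial.monomial (Finsupp.equivFunOnFinite.symm α)
      (c α * (Nat.multinomial Finset.univ α : ℝ))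
  have hP : P = 0 := by
    refine MvPolynomial.funext fun y => ?_
    rw [map_zero, ← hall (WithLp.toLp 2 y)]
    simp only [P, map_sum, MvPolynomial.eval_monomial, dirCoeff]
    refine Finset.sum_congr rfl fun α _ => ?_
    rw [Finsupp.prod_fintype _ _ (by simp), mul_assoc]
    rfl
  intro α hα
  have h1 : MvPolynomial.coeff (Finsupp.equivFunOnFinite.symm α) P =
      c α * (Nat.multinomial Finset.univ α : ℝ) := by
    simp only [P, MvPolynomial.coeff_sum, MvPolynomial.coeff_monomial]
    rw [Finset.sum_eq_single α]
    · simp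
    · intro β _ hβ
      rw [if_neg fun h => hβ (Finsupp.equivFunOnFinite.symm.injective h)]
    · exact fun h => absurd hα h
  rw [hP, MvPolynomial.coeff_zero] at h1
  refine (mul_eq_zero.1 h1.symm).resolve_right ?_
  exact_mod_cast (Nat.multinomial_pos _ _).ne'

/-- The coefficients of a form of degree `k` can be recovered from its values at finitely many
points of the unit ball. -/
theorem exists_interpolation (N k : ℕ) :
    ∃ (T : Finset (E N)) (a : (Fin N → ℕ) → E N → ℝ), (∀ y ∈ T, ‖y‖ < 1) ∧
      ∀ α ∈ multiIndices N k, ∀ β ∈ multiIndices N k,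
        ∑ y ∈ T, a α y * dirCoeff β y = if α = β then 1 else 0 := by
  classical
  let ι := {α // α ∈ multiIndices N k}
  let v : {y : E N // ‖y‖ < 1} → ι → ℝ := fun y β => dirCoeff β.1 y.1
  have hspan : Submodule.span ℝ (Set.range v) = ⊤ := by
    by_contra hne
    obtain ⟨F, hF0, hF⟩ := Submodule.exists_le_ker_of_lt_top _ (lt_top_iff_ne_top.2 hne)
    apply hF0
    let c : (Fin N → ℕ) → ℝ := fun α =>
      if hα : α ∈ multiIndices N k then F (Pi.single ⟨α, hα⟩ 1) else 0
    have hFw : ∀ w : ι → ℝ, F w = ∑ β : ι, c β.1 * w β := by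
      intro w
      conv_lhs => rw [LinearMap.pi_apply_eq_sum_univ F w]
      refine Finset.sum_congr rfl fun β _ => ?_
      simp only [c, dif_pos β.2, smul_eq_mul]
      rw [mul_comm]
      congr 2
      ext γ
      simp [Pi.single_apply, eq_comm]
    have hc : ∀ α ∈ multiIndices N k, c α = 0 := by
      refine eq_zero_of_forall_sum_mul_dirCoeff fun y hy => ?_
      have h1 : F (v ⟨y, hy⟩) = 0 := hF (Submodule.subset_span ⟨⟨y, hy⟩, rfl⟩)
      rw [hFw] at h1
      rw [← Finset.sum_coe_sort]
      exact h1
    ext w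
    simp only [LinearMap.comp_apply, hFw, LinearMap.zero_apply]
    exact Finset.sum_eq_zero fun β _ => by rw [hc β.1 β.2, zero_mul]
  -- Each coordinate vector is a combination of the vectors `v y`.
  have hex : ∀ α : ι, ∃ c : {y : E N // ‖y‖ < 1} →₀ ℝ,
      (c.sum fun y r => r • v y) = Pi.single α 1 := fun α =>
    Finsupp.mem_span_range_iff_exists_finsupp.1 (hspan ▸ Submodule.mem_top)
  choose c hc using hex
  let T' : Finset {y : E N // ‖y‖ < 1} := Finset.univ.biUnion fun α : ι => (c α).support
  refine ⟨T'.map (Function.Embedding.subtype _), fun α y =>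
    if h : α ∈ multiIndices N k ∧ ‖y‖ < 1 then c ⟨α, h.1⟩ ⟨y, h.2⟩ else 0, ?_, ?_⟩
  · intro y hy
    obtain ⟨y', -, rfl⟩ := Finset.mem_map.1 hy
    exact y'.2
  · intro α hα β hβ
    have h1 := congrFun (hc ⟨α, hα⟩) ⟨β, hβ⟩
    rw [Finsupp.sum_of_support_subset (s := T') _
      (Finset.subset_biUnion_of_mem (fun α : ι => (c α).support) (Finset.mem_univ _)) _
      (by simp)] at h1
    rw [Finset.sum_apply] at h1
    rw [Finset.sum_map]
    have h2 : (Pi.single (⟨α, hα⟩ : ι) (1 : ℝ) : ι → ℝ) ⟨β, hβ⟩ = if α = β then 1 else 0 := by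
      rw [Pi.single_apply]
      exact if_congr (by rw [Subtype.mk.injEq, eq_comm]) rfl rfl
    rw [← h2, ← h1]
    refine Finset.sum_congr rfl fun y _ => ?_
    exact congrArg (· * dirCoeff β y.1) (dif_pos ⟨hα, y.2⟩)

variable {𝕜 : Type*} [RCLike 𝕜]

theorem RINorm.segNorm_zero_le_add (X : RINorm N) {k : ℕ} {g : (Fin N → ℕ) → E N → 𝕜}
    (hgm : ∀ α, StronglyMeasurable (g α)) (y z : E N) :
    X.segNorm k g 0 y ≤ X.segNorm k g 0 z +
      (∑ α ∈ multiIndices N k, ‖dirCoeff α y - dirCoeff α z‖ₑ) * X.fullNorm k g := by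
  have h1 := stronglyMeasurable_dirSum k hgm
  have h2 : StronglyMeasurable fun x =>
      ∑ α ∈ multiIndices N k, (dirCoeff α y - dirCoeff α z) • g α x :=
    Finset.stronglyMeasurable_fun_sum _ fun α _ => (hgm α).const_smul _
  refine le_trans ?_ (add_le_add_right (X.norm_sum_smul_le_fullNorm (k := k) hgm
    fun α => dirCoeff α y - dirCoeff α z) _)
  rw [X.segNorm_zero, X.segNorm_zero]
  refine le_trans ?_ (X.norm_add_le _ _ (h1 z).enorm.aemeasurable h2.enorm.aemeasurable)
  refine X.norm_mono _ _ (h1 y).enorm.aemeasurable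
    ((h1 z).enorm.add h2.enorm).aemeasurable (Eventually.of_forall fun x => ?_)
  refine le_trans (le_of_eq ?_) (enorm_add_le _ _)
  simp only [dirSum, sub_smul, Finset.sum_sub_distrib]
  congr 1
  abel

/-- On the unit ball all monomials `y^α` are bounded by one. -/
theorem RINorm.segNorm_zero_le (X : RINorm N) {k : ℕ} {g : (Fin N → ℕ) → E N → 𝕜}
    (hgm : ∀ α, StronglyMeasurable (g α)) {y : E N} (hy : ‖y‖ ≤ 1) :
    X.segNorm k g 0 y ≤
      (∑ α ∈ multiIndices N k, (Nat.multinomial Finset.univ α : ℝ≥0) : ℝ≥0) * X.fullNorm k g := by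
  rw [X.segNorm_zero]
  refine (X.norm_sum_smul_le_fullNorm hgm fun α => dirCoeff α y).trans ?_
  gcongr
  rw [ENNReal.ofNNReal_finsetSum]
  refine Finset.sum_le_sum fun α _ => ?_
  rw [enorm_eq_nnnorm, ENNReal.coe_le_coe, ← NNReal.coe_le_coe, coe_nnnorm, dirCoeff,
    _root_.norm_mul, Real.norm_natCast, NNReal.coe_natCast, norm_prod]
  refine mul_le_of_le_one_right (Nat.cast_nonneg _) (Finset.prod_le_one (fun _ _ => norm_nonneg _)
    fun i _ => ?_)
  rw [norm_pow]
  exact pow_le_one₀ (norm_nonneg _) ((PiLp.norm_apply_le y i).trans hy)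

/-- At one of the interpolation points `y` the derivative in that direction controls the full
gradient, and it still does so, up to a factor, at all nearby points. -/
theorem exists_fullNorm_rpow_le (𝕜 : Type*) [RCLike 𝕜] (N k : ℕ) {p : ℝ} (hp : 0 < p) :
    ∃ C : ℝ≥0, ∀ (X : RINorm N) (g : (Fin N → ℕ) → E N → 𝕜), (∀ α, StronglyMeasurable (g α)) →
      X.fullNorm k g < ∞ →
      X.fullNorm k g ^ p ≤ C * ∫⁻ y in Metric.ball (0 : E N) 1, X.segNorm k g 0 y ^ p := by
  obtain ⟨T, a, hT, ha⟩ := exists_interpolation N k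
  set L : ℝ≥0 := ∑ α ∈ multiIndices N k, ∑ y ∈ T, ‖a α y‖₊ with hL
  have hδ : ∀ y : E N, ∃ δ > 0, y ∈ T → ∀ z ∈ Metric.ball y δ, z ∈ Metric.ball (0 : E N) 1 ∧
      L * ∑ α ∈ multiIndices N k, ‖dirCoeff α y - dirCoeff α z‖ₑ ≤ 2⁻¹ := by
    intro y
    by_cases hy : y ∈ T
    · have hc : Tendsto (fun z => (L : ℝ≥0∞) * ∑ α ∈ multiIndices N k,
          ‖dirCoeff α y - dirCoeff α z‖ₑ) (𝓝 y) (𝓝 (L * ∑ α ∈ multiIndices N k, 0)) := by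
        refine ENNReal.Tendsto.const_mul (tendsto_finsetSum _ fun α _ => ?_) (Or.inr (by simp))
        have := ((continuous_const (y := dirCoeff α y)).sub
          (continuous_dirCoeff (N := N) α)).enorm.tendsto y
        simpa using this
      have h1 : ∀ᶠ z in 𝓝 y, z ∈ Metric.ball (0 : E N) 1 ∧
          L * ∑ α ∈ multiIndices N k, ‖dirCoeff α y - dirCoeff α z‖ₑ ≤ 2⁻¹ := by
        have h2 : ∀ᶠ z in 𝓝 y, z ∈ Metric.ball (0 : E N) 1 :=
          Metric.isOpen_ball.mem_nhds (by simpa using hT y hy)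
        exact h2.and <| (hc.eventually_lt_const (by simp)).mono fun _ h => h.le
      obtain ⟨δ, hδ0, hδ⟩ := Metric.eventually_nhds_iff_ball.1 h1
      exact ⟨δ, hδ0, fun _ => hδ⟩
    · exact ⟨1, one_pos, fun h => absurd h hy⟩
  choose δ hδ0 hδ using hδ
  have hvol : ∀ y, volume (Metric.ball y (δ y)) ≠ 0 := fun y =>
    (Metric.measure_ball_pos volume y (hδ0 y)).ne'
  refine ⟨∑ y ∈ T, ((volume (Metric.ball y (δ y)))⁻¹).toNNReal * (2 * L) ^ p,
    fun X g hgm hfin => ?_⟩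
  -- the gradient is controlled by the interpolation points
  have h1 : ∀ α ∈ multiIndices N k, X.norm (fun x => ‖g α x‖ₑ) ≤
      ∑ y ∈ T, ‖a α y‖ₑ * X.segNorm k g 0 y := by
    intro α hα
    have hgα : ∀ x, g α x = ∑ y ∈ T, a α y • dirSum k g y x := by
      intro x
      simp only [dirSum, Finset.smul_sum, smul_smul]
      rw [Finset.sum_comm]
      simp only [← Finset.sum_smul]
      rw [Finset.sum_congr rfl fun β hβ => by rw [ha α hα β hβ]]
      simp [hα]
    have hm := stronglyMeasurable_dirSum k hgm
    have h2 : ∀ y, ‖a α y‖ₑ * X.segNorm k g 0 y = X.norm fun x => ‖a α y • dirSum k g y x‖ₑ := by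
      intro y
      rw [X.segNorm_zero]
      refine (X.norm_mul ‖a α y‖₊ _ (hm y).enorm.aemeasurable).symm.trans ?_
      simp only [enorm_smul]
      rfl
    simp only [h2]
    refine le_trans ?_ (X.norm_sum_le T _ fun y _ => ((hm y).const_smul _).enorm.aemeasurable)
    refine X.norm_mono _ _ (hgm α).enorm.aemeasurable (Finset.measurable_fun_sum _ fun y _ =>
      ((hm y).const_smul (a α y)).enorm).aemeasurable (Eventually.of_forall fun x => ?_)
    simp only [hgα x]
    exact enorm_sum_le _ _
  have h2 : X.fullNorm k g ≤ ∑ α ∈ multiIndices N k, ∑ y ∈ T, ‖a α y‖ₑ * X.segNorm k g 0 y :=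
    (X.fullNorm_le_sum hgm).trans (Finset.sum_le_sum h1)
  rcases T.eq_empty_or_nonempty with hTe | hTne
  · have : X.fullNorm k g = 0 := by simpa [hTe] using h2
    rw [this, ENNReal.zero_rpow_of_pos hp]
    exact zero_le
  obtain ⟨y, hyT, hymax⟩ := T.exists_max_image (fun y => X.segNorm k g 0 y) hTne
  have h3 : X.fullNorm k g ≤ L * X.segNorm k g 0 y := by
    refine h2.trans ?_
    rw [hL]
    push_cast
    simp only [Finset.sum_mul]
    refine Finset.sum_le_sum fun α _ => Finset.sum_le_sum fun z hz => ?_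
    exact mul_le_mul_right (hymax z hz) _
  -- near `y` the error made by passing from `y` to `z` is absorbed by the left-hand side
  have h4 : ∀ z ∈ Metric.ball y (δ y), X.fullNorm k g ≤ (2 * L : ℝ≥0) * X.segNorm k g 0 z := by
    intro z hz
    have h5 : X.fullNorm k g ≤ L * X.segNorm k g 0 z + 2⁻¹ * X.fullNorm k g := by
      refine h3.trans ((mul_le_mul_right (X.segNorm_zero_le_add hgm y z) _).trans ?_)
      rw [mul_add, ← mul_assoc]
      gcongr
      exact (hδ y hyT z hz).2
    have h6 : 2⁻¹ * X.fullNorm k g + 2⁻¹ * X.fullNorm k g = X.fullNorm k g := by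
      rw [← add_mul, ENNReal.inv_two_add_inv_two, one_mul]
    have h7 : 2⁻¹ * X.fullNorm k g ≤ L * X.segNorm k g 0 z := by
      refine ENNReal.le_of_add_le_add_right (a := 2⁻¹ * X.fullNorm k g)
        (ENNReal.mul_ne_top (by simp) hfin.ne) ?_
      rwa [h6]
    calc X.fullNorm k g = 2 * (2⁻¹ * X.fullNorm k g) := by
          rw [← mul_assoc, ENNReal.mul_inv_cancel (by simp) (by simp), one_mul]
      _ ≤ 2 * (L * X.segNorm k g 0 z) := by gcongr
      _ = _ := by push_cast; rw [mul_assoc]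
  -- integrate over the ball around `y`, which lies in the unit ball
  have h5 : volume (Metric.ball y (δ y)) * X.fullNorm k g ^ p ≤
      ((2 * L) ^ p : ℝ≥0) * ∫⁻ z in Metric.ball (0 : E N) 1, X.segNorm k g 0 z ^ p := by
    rw [mul_comm, ← setLIntegral_const, ← lintegral_const_mul' _ _ ENNReal.coe_ne_top]
    refine le_trans ?_ (lintegral_mono_set fun z hz => (hδ y hyT z hz).1)
    refine setLIntegral_mono' measurableSet_ball fun z hz => ?_
    rw [ENNReal.coe_rpow_of_nonneg _ hp.le, ← ENNReal.mul_rpow_of_nonneg _ _ hp.le]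
    exact ENNReal.rpow_le_rpow (h4 z hz) hp.le
  have h6 : X.fullNorm k g ^ p ≤ (((volume (Metric.ball y (δ y)))⁻¹).toNNReal * (2 * L) ^ p :
      ℝ≥0) * ∫⁻ z in Metric.ball (0 : E N) 1, X.segNorm k g 0 z ^ p := by
    rw [ENNReal.coe_mul, mul_assoc, ENNReal.coe_toNNReal (ENNReal.inv_ne_top.2 (hvol y))]
    refine le_trans ?_ (mul_le_mul_right h5 _)
    rw [← mul_assoc, ENNReal.inv_mul_cancel (hvol y) measure_ball_lt_top.ne, one_mul]
  refine h6.trans ?_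
  gcongr
  exact Finset.single_le_sum (f := fun y =>
    ((volume (Metric.ball y (δ y)))⁻¹).toNNReal * (2 * L) ^ p) (fun _ _ => zero_le) hyT

end Coercivity

/-! ### Polar coordinates and scaling -/

section Scaling

variable {N : ℕ}

theorem lintegral_ball_zero_eq {r : ℝ} (hr : 0 < r) {F : E N → ℝ≥0∞} (hF : Measurable F) :
    ∫⁻ y in Metric.ball (0 : E N) r, F y =
      ENNReal.ofReal (r ^ N) * ∫⁻ y in Metric.ball (0 : E N) 1, F (r • y) := by
  have h1 := Measure.map_addHaar_smul (volume : Measure (E N)) hr.ne'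
  have h2 : ∀ y, (Metric.ball (0 : E N) 1).indicator (fun y => F (r • y)) y =
      (Metric.ball (0 : E N) r).indicator F (r • y) := by
    intro y
    simp only [Set.indicator, mem_ball_zero_iff, norm_smul, Real.norm_eq_abs, abs_of_pos hr,
      mul_lt_iff_lt_one_right hr]
  rw [← lintegral_indicator measurableSet_ball, ← lintegral_indicator measurableSet_ball]
  simp only [h2]
  have h3 := lintegral_map (μ := (volume : Measure (E N)))
    (hF.indicator (measurableSet_ball (x := (0 : E N)) (ε := r))) (measurable_const_smul r)
  rw [h1, lintegral_smul_measure, finrank_euclideanSpace_fin, smul_eq_mul] at h3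
  rw [← h3, ← mul_assoc, ← ENNReal.ofReal_mul (by positivity), abs_of_pos (by positivity),
    mul_inv_cancel₀ (by positivity), ENNReal.ofReal_one, one_mul]

theorem lintegral_volumeIoiPow_rpow (n : ℕ) {q : ℝ} (hq : 0 < q) :
    ∫⁻ t, (Set.Iio (1 : ℝ)).indicator (fun t => ENNReal.ofReal (t ^ q)) t.1
      ∂Measure.volumeIoiPow n = ENNReal.ofReal (1 / (q + (n + 1 : ℕ))) := by
  have hm : Measurable fun t : ℝ => (Set.Iio (1 : ℝ)).indicator
      (fun t => ENNReal.ofReal (t ^ q)) t :=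
    Measurable.indicator (by fun_prop) measurableSet_Iio
  have hm' : Measurable fun t : Set.Ioi (0 : ℝ) => (Set.Iio (1 : ℝ)).indicator
      (fun t => ENNReal.ofReal (t ^ q)) t.1 := hm.comp measurable_subtype_coe
  rw [Measure.volumeIoiPow, lintegral_withDensity_eq_lintegral_mul _ (by fun_prop) hm']
  simp only [Pi.mul_apply]
  rw [lintegral_subtype_comap measurableSet_Ioi fun t : ℝ => ENNReal.ofReal (t ^ n) *
    (Set.Iio (1 : ℝ)).indicator (fun t => ENNReal.ofReal (t ^ q)) t]
  have h1 : ∀ t ∈ Set.Ioi (0 : ℝ), ENNReal.ofReal (t ^ n) *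
      (Set.Iio (1 : ℝ)).indicator (fun t => ENNReal.ofReal (t ^ q)) t =
      (Set.Iio (1 : ℝ)).indicator (fun t => ENNReal.ofReal (t ^ (n + q))) t := by
    intro t (ht : 0 < t)
    by_cases h : t ∈ Set.Iio (1 : ℝ)
    · rw [Set.indicator_of_mem h, Set.indicator_of_mem h, ← ENNReal.ofReal_mul (by positivity),
        Real.rpow_add ht, Real.rpow_natCast]
    · rw [Set.indicator_of_notMem h, Set.indicator_of_notMem h, mul_zero]
  rw [setLIntegral_congr_fun measurableSet_Ioi h1, setLIntegral_indicator measurableSet_Iio,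
    Set.Iio_inter_Ioi, restrict_Ioo_eq_restrict_Ioc]
  have hint : IntegrableOn (fun t : ℝ => t ^ (n + q)) (Set.Ioc 0 1) :=
    (intervalIntegral.intervalIntegrable_rpow' (a := 0) (b := 1) (r := n + q)
      (by have := n.cast_nonneg (α := ℝ); linarith)).1
  rw [← ofReal_integral_eq_lintegral_ofReal hint
    ((ae_restrict_mem measurableSet_Ioc).mono fun t ht => Real.rpow_nonneg ht.1.le _),
    ← intervalIntegral.integral_of_le zero_le_one,
    integral_rpow (Or.inl (by have := n.cast_nonneg (α := ℝ); linarith)), Real.one_rpow,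
    Real.zero_rpow (by positivity)]
  congr 2
  · ring
  · push_cast; ring

/-- Polar coordinates for a positively homogeneous function. -/
theorem lintegral_ball_eq_lintegral_sphere (hN : 1 ≤ N) {q : ℝ} (hq : 0 < q) {F : E N → ℝ≥0∞}
    (hF : Measurable F) (hom : ∀ t : ℝ, 0 < t → ∀ y, F (t • y) = ENNReal.ofReal (t ^ q) * F y) :
    ∫⁻ y in Metric.ball (0 : E N) 1, F y = ENNReal.ofReal (1 / (q + N)) *
      ∫⁻ ω : Metric.sphere (0 : E N) 1, F ω ∂(volume : Measure (E N)).toSphere := by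
  have : Nonempty (Fin N) := ⟨⟨0, hN⟩⟩
  have hF' := hF.indicator (measurableSet_ball (x := (0 : E N)) (ε := 1))
  have hmp := (volume : Measure (E N)).measurePreserving_homeomorphUnitSphereProd
  rw [finrank_euclideanSpace_fin] at hmp
  have h1 := hmp.lintegral_comp_emb (Homeomorph.measurableEmbedding _)
    fun z => (Metric.ball (0 : E N) 1).indicator F (z.2.1 • z.1.1)
  have h2 : ∀ y : ({0}ᶜ : Set (E N)), (homeomorphUnitSphereProd (E N) y).2.1 •
      (homeomorphUnitSphereProd (E N) y).1.1 = y.1 := by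
    intro y
    have : ‖y.1‖ ≠ 0 := norm_ne_zero_iff.2 y.2
    simp [smul_smul, mul_inv_cancel₀ this]
  have h3 : ∀ z : Metric.sphere (0 : E N) 1 × Set.Ioi (0 : ℝ),
      (Metric.ball (0 : E N) 1).indicator F (z.2.1 • z.1.1) = F z.1.1 *
        (Set.Iio (1 : ℝ)).indicator (fun t => ENNReal.ofReal (t ^ q)) z.2.1 := by
    intro z
    have hz : 0 < z.2.1 := z.2.2
    have hz1 : ‖z.2.1 • z.1.1‖ = z.2.1 := by
      rw [norm_smul, mem_sphere_zero_iff_norm.1 z.1.2, mul_one, Real.norm_eq_abs, abs_of_pos hz]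
    simp only [Set.indicator, mem_ball_zero_iff, hz1, Set.mem_Iio]
    split_ifs
    · rw [hom _ hz, mul_comm]
    · rw [mul_zero]
  simp only [h2, h3] at h1
  have hm : Measurable fun t : Set.Ioi (0 : ℝ) => (Set.Iio (1 : ℝ)).indicator
      (fun t => ENNReal.ofReal (t ^ q)) t.1 :=
    (Measurable.indicator (by fun_prop) measurableSet_Iio).comp measurable_subtype_coe
  rw [lintegral_prod_mul (f := fun ω : Metric.sphere (0 : E N) 1 => F ω.1)
    (hF.comp measurable_subtype_coe).aemeasurable hm.aemeasurable,
    lintegral_volumeIoiPow_rpow _ hq, Nat.sub_add_cancel hN,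
    lintegral_subtype_comap (measurableSet_singleton _).compl, restrict_compl_singleton,
    lintegral_indicator measurableSet_ball, mul_comm] at h1
  exact h1

end Scaling

/-! ### The energy as a weighted average of integrals over the unit ball -/

section Energy

variable {N : ℕ} {𝕜 : Type*} [RCLike 𝕜] (X : RINorm N) {k : ℕ} {g : (Fin N → ℕ) → E N → 𝕜}

/-- For `r > 0` the integral over the unit ball of `(r^{-k} ‖Δ_{r y}^k f‖_X)^p`, and for `r = 0`
that of `‖∂_y^k f‖_X^p`. -/
def RINorm.ballEnergy (X : RINorm N) (k : ℕ) (p : ℝ) (g : (Fin N → ℕ) → E N → 𝕜) (r : ℝ) : ℝ≥0∞ :=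
  ∫⁻ y in Metric.ball (0 : E N) 1, X.segNorm k g r y ^ p

theorem RINorm.ballEnergy_le (hgm : ∀ α, StronglyMeasurable (g α)) {p : ℝ} (hp : 0 < p) (r : ℝ) :
    X.ballEnergy k p g r ≤ X.ballEnergy k p g 0 :=
  lintegral_mono fun y => ENNReal.rpow_le_rpow (X.segNorm_le_segNorm_zero hgm r y) hp.le

theorem RINorm.measurable_segNorm (hgm : ∀ α, StronglyMeasurable (g α))
    (hg : ∀ α ∈ multiIndices N k, LocallyIntegrable (g α) volume) (r : ℝ) :
    Measurable (X.segNorm k g r) := by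
  have h1 : LowerSemicontinuous fun y : E N => X.segNorm k g r y := fun y a ha =>
    (Continuous.prodMk_right r).continuousAt.eventually
      (X.lowerSemicontinuous_segNorm hgm hg (r, y) a ha)
  exact h1.measurable

theorem exists_ballEnergy_zero_le (𝕜 : Type*) [RCLike 𝕜] (N k : ℕ) {p : ℝ} (hp : 0 < p) :
    ∃ C : ℝ≥0, ∀ (X : RINorm N) (g : (Fin N → ℕ) → E N → 𝕜), (∀ α, StronglyMeasurable (g α)) →
      X.ballEnergy k p g 0 ≤ C * X.fullNorm k g ^ p := by
  refine ⟨(∑ α ∈ multiIndices N k, (Nat.multinomial Finset.univ α : ℝ≥0)) ^ p *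
    (volume (Metric.ball (0 : E N) 1)).toNNReal, fun X g hgm => ?_⟩
  refine (setLIntegral_mono' measurableSet_ball fun y hy => ENNReal.rpow_le_rpow
    (X.segNorm_zero_le hgm (mem_ball_zero_iff.1 hy).le) hp.le).trans ?_
  rw [setLIntegral_const, ENNReal.mul_rpow_of_nonneg _ _ hp.le, ENNReal.coe_mul,
    ENNReal.coe_toNNReal measure_ball_lt_top.ne, ENNReal.coe_rpow_of_nonneg _ hp.le]
  exact le_of_eq (by ring)

/-- The integrand is dominated by its value at `r = 0`, so lower semicontinuity gives pointwise
convergence, and dominated convergence applies. -/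
theorem RINorm.tendsto_ballEnergy (hgm : ∀ α, StronglyMeasurable (g α))
    (hg : ∀ α ∈ multiIndices N k, LocallyIntegrable (g α) volume) {p : ℝ} (hp : 0 < p)
    (hfin : X.ballEnergy k p g 0 ≠ ∞) :
    Tendsto (X.ballEnergy k p g) (𝓝 0) (𝓝 (X.ballEnergy k p g 0)) := by
  refine tendsto_lintegral_filter_of_dominated_convergence (fun y => X.segNorm k g 0 y ^ p)
    (Eventually.of_forall fun r => (X.measurable_segNorm hgm hg r).pow_const p)
    (Eventually.of_forall fun r => Eventually.of_forall fun y =>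
      ENNReal.rpow_le_rpow (X.segNorm_le_segNorm_zero hgm r y) hp.le) hfin
    (Eventually.of_forall fun y => ?_)
  refine (ENNReal.continuous_rpow_const.tendsto _).comp ?_
  refine tendsto_order.2 ⟨fun a ha => ?_, fun a ha => Eventually.of_forall fun r =>
    (X.segNorm_le_segNorm_zero hgm r y).trans_lt ha⟩
  have h1 : Tendsto (fun r : ℝ => (r, y)) (𝓝 0) (𝓝 (0, y)) :=
    (Continuous.prodMk_left y).tendsto 0
  exact h1.eventually (X.lowerSemicontinuous_segNorm hgm hg (0, y) a ha)

/-- Integrate first in `h`, over the ball `‖h‖ < u^{1/k}`, and rescale it to the unit ball. The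
powers of `u` cancel. -/
theorem RINorm.energy_eq {f : Distr N 𝕜} (hk : 1 ≤ k) {p : ℝ} (hp : 0 < p)
    (hgm : ∀ α, StronglyMeasurable (g α))
    (hg : ∀ α ∈ multiIndices N k, Represents (partialDeriv α f) (g α)) {w : ℝ → ℝ}
    (hw : AEMeasurable w (volume.restrict (Set.Ioi 0))) :
    energy X k p w f = ∫⁻ u in Set.Ioi (0 : ℝ), ENNReal.ofReal (w u) *
      X.ballEnergy k p g (u ^ (1 / k : ℝ)) := by
  have hk0 : k ≠ 0 := by omega
  have hkpos : (0 : ℝ) < k := by positivity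
  have hgl := fun α hα => (hg α hα).1
  have hD : ∀ (r : ℝ) (y : E N), X.distNorm (diff k (r • y) f) = ‖r ^ k‖ₑ * X.segNorm k g r y :=
    X.distNorm_diff hgm hg
  have hD1 : ∀ h : E N, X.distNorm (diff k h f) = X.segNorm k g 1 h := fun h => by
    simpa using hD 1 h
  have hDm : Measurable fun h : E N => X.distNorm (diff k h f) ^ p := by
    simp only [hD1]
    exact (X.measurable_segNorm hgm hgl 1).pow_const p
  set W : ℝ → ℝ≥0∞ := fun u => ENNReal.ofReal (u ^ (-p - (N : ℝ) / k) * w u) with hW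
  have hWm : AEMeasurable W (volume.restrict (Set.Ioi 0)) :=
    (AEMeasurable.mul (by fun_prop) hw).ennreal_ofReal
  set S : Set (E N × ℝ) := {q | ‖q.1‖ ^ k < q.2} with hS
  have hSm : MeasurableSet S := measurableSet_lt (by fun_prop) (by fun_prop)
  have hphi : ∀ h : E N, X.distNorm (diff k h f) ^ p * phi N k p w ‖h‖ =
      ∫⁻ u in Set.Ioi (0 : ℝ), S.indicator
        (fun q => X.distNorm (diff k q.1 f) ^ p * W q.2) (h, u) := by
    intro h
    have h1 : ∀ u, S.indicator (fun q => X.distNorm (diff k q.1 f) ^ p * W q.2) (h, u) =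
        (Set.Ioi (‖h‖ ^ k)).indicator (fun u => X.distNorm (diff k h f) ^ p * W u) u :=
      fun u => rfl
    simp only [h1]
    have h2 : Set.Ioi (‖h‖ ^ k) ⊆ Set.Ioi 0 := Set.Ioi_subset_Ioi (by positivity)
    rw [setLIntegral_indicator measurableSet_Ioi, Set.inter_eq_left.2 h2,
      lintegral_const_mul'' _ (hWm.mono_set h2)]
    rfl
  rw [energy]
  simp only [hphi]
  rw [lintegral_lintegral_swap]
  swap
  · refine AEMeasurable.indicator (AEMeasurable.mul (hDm.comp measurable_fst).aemeasurable ?_) hSm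
    exact hWm.comp_quasiMeasurePreserving Measure.quasiMeasurePreserving_snd
  refine setLIntegral_congr_fun measurableSet_Ioi fun u (hu : 0 < u) => ?_
  set r : ℝ := u ^ (1 / k : ℝ) with hr
  have hr0 : 0 < r := Real.rpow_pos_of_pos hu _
  have hrk : r ^ k = u := by
    rw [hr, ← Real.rpow_natCast, ← Real.rpow_mul hu.le, one_div, inv_mul_cancel₀ hkpos.ne',
      Real.rpow_one]
  have h1 : ∀ h : E N, S.indicator (fun q => X.distNorm (diff k q.1 f) ^ p * W q.2) (h, u) =
      (Metric.ball (0 : E N) r).indicator (fun h => X.distNorm (diff k h f) ^ p * W u) h := by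
    intro h
    have : ‖h‖ ^ k < u ↔ ‖h‖ < r := by
      rw [← hrk, pow_lt_pow_iff_left₀ (norm_nonneg _) hr0.le hk0]
    simp only [Set.indicator, hS, Set.mem_ofPred_eq, mem_ball_zero_iff, this]
  simp only [h1]
  rw [lintegral_indicator measurableSet_ball, lintegral_mul_const _ hDm,
    lintegral_ball_zero_eq hr0 hDm]
  simp only [hD, hrk]
  have h2 : ∀ y : E N, (‖u‖ₑ * X.segNorm k g r y) ^ p =
      ENNReal.ofReal (u ^ p) * X.segNorm k g r y ^ p := by
    intro y
    rw [ENNReal.mul_rpow_of_nonneg _ _ hp.le, Real.enorm_eq_ofReal hu.le,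
      ENNReal.ofReal_rpow_of_pos hu]
  simp only [h2]
  rw [lintegral_const_mul _ ((X.measurable_segNorm hgm hgl r).pow_const p), ← RINorm.ballEnergy,
    mul_comm, ← mul_assoc, ← mul_assoc]
  simp only [hW]
  rw [ENNReal.ofReal_mul (by positivity)]
  have h3 : ENNReal.ofReal (u ^ (-p - (N : ℝ) / k)) * ENNReal.ofReal (r ^ N) *
      ENNReal.ofReal (u ^ p) = 1 := by
    rw [← ENNReal.ofReal_mul (by positivity), ← ENNReal.ofReal_mul (by positivity), hr,
      ← Real.rpow_natCast, ← Real.rpow_mul hu.le, ← Real.rpow_add hu, ← Real.rpow_add hu]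
    rw [show -p - (N : ℝ) / k + 1 / k * N + p = 0 by ring, Real.rpow_zero, ENNReal.ofReal_one]
  calc _ = ENNReal.ofReal (u ^ (-p - (N : ℝ) / k)) * ENNReal.ofReal (r ^ N) *
        ENNReal.ofReal (u ^ p) * (ENNReal.ofReal (w u) * X.ballEnergy k p g r) := by ring
    _ = _ := by rw [h3, one_mul]

/-- The Bochner integral of a non-integrable function would be zero. -/
theorem IsNormalized.integrableOn {ρ : ℝ → ℝ → ℝ} (hρ : IsNormalized ρ) {ε : ℝ} (hε : 0 < ε) :
    IntegrableOn (ρ ε) (Set.Ioi 0) :=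
  Integrable.of_integral_ne_zero (by rw [(hρ ε hε).2]; exact one_ne_zero)

theorem IsNormalized.setLIntegral_ofReal {ρ : ℝ → ℝ → ℝ} (hρ : IsNormalized ρ) {ε : ℝ}
    (hε : 0 < ε) {s : Set ℝ} (hs : MeasurableSet s) (hs0 : s ⊆ Set.Ioi 0) :
    ∫⁻ u in s, ENNReal.ofReal (ρ ε u) = ENNReal.ofReal (∫ u in s, ρ ε u) :=
  (ofReal_integral_eq_lintegral_ofReal ((hρ.integrableOn hε).mono_set hs0)
    ((ae_restrict_mem hs).mono fun u hu => (hρ ε hε).1 u (hs0 hu))).symm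

theorem RINorm.energy_le {f : Distr N 𝕜} (hk : 1 ≤ k) {p : ℝ} (hp : 0 < p)
    (hgm : ∀ α, StronglyMeasurable (g α))
    (hg : ∀ α ∈ multiIndices N k, Represents (partialDeriv α f) (g α)) {ρ : ℝ → ℝ → ℝ}
    (hρ : IsNormalized ρ) {ε : ℝ} (hε : 0 < ε) :
    energy X k p (ρ ε) f ≤ X.ballEnergy k p g 0 := by
  have hm := (hρ.integrableOn hε).aemeasurable
  rw [X.energy_eq hk hp hgm hg hm]
  refine (lintegral_mono fun u => mul_le_mul_right (X.ballEnergy_le hgm hp _) _).trans ?_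
  rw [lintegral_mul_const'' _ hm.ennreal_ofReal,
    hρ.setLIntegral_ofReal hε measurableSet_Ioi subset_rfl, (hρ ε hε).2, ENNReal.ofReal_one,
    one_mul]

/-- The lower bound for the limit comes from the part of the integral over `0 < u < a` alone, where
`B(u^{1/k})` is close to `B(0)` if `a` is small, and which carries almost all the mass of `ρ ε`. -/
theorem RINorm.tendsto_energy {f : Distr N 𝕜} (hk : 1 ≤ k) {p : ℝ} (hp : 0 < p)
    (hgm : ∀ α, StronglyMeasurable (g α))
    (hg : ∀ α ∈ multiIndices N k, Represents (partialDeriv α f) (g α))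
    (hfin : X.ballEnergy k p g 0 ≠ ∞) {ρ : ℝ → ℝ → ℝ} (hρ : IsNormalized ρ)
    (hc : Concentrates ρ) :
    Tendsto (fun ε => energy X k p (ρ ε) f) (𝓝[>] 0) (𝓝 (X.ballEnergy k p g 0)) := by
  have hpos : ∀ᶠ ε : ℝ in 𝓝[>] 0, 0 < ε := eventually_mem_nhdsWithin
  refine tendsto_order.2 ⟨fun b hb => ?_, fun b hb => hpos.mono fun ε hε =>
    (X.energy_le hk hp hgm hg hρ hε).trans_lt hb⟩
  obtain ⟨c, hbc, hcB⟩ := exists_between hb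
  have hroot : Tendsto (fun u : ℝ => u ^ (1 / k : ℝ)) (𝓝 0) (𝓝 0) := by
    have h1 : (0 : ℝ) < 1 / k := by positivity
    have h2 := (Real.continuousAt_rpow_const 0 (1 / k : ℝ) (Or.inr h1.le)).tendsto
    rwa [Real.zero_rpow h1.ne'] at h2
  have h1 := ((X.tendsto_ballEnergy hgm (fun α hα => (hg α hα).1) hp hfin).comp
    hroot).eventually_const_lt hcB
  obtain ⟨δ, hδ0, hδ⟩ := Metric.eventually_nhds_iff_ball.1 h1
  -- concentration is only assumed on intervals `(0, a)` with `a < 1`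
  set a : ℝ := min δ 2⁻¹ with ha
  have ha0 : 0 < a := lt_min hδ0 (by norm_num)
  have ha1 : a < 1 := (min_le_right _ _).trans_lt (by norm_num)
  have h2 : Tendsto (fun ε => c * ENNReal.ofReal (∫ u in Set.Ioo 0 a, ρ ε u)) (𝓝[>] 0) (𝓝 c) := by
    simpa using ENNReal.Tendsto.const_mul (a := c)
      ((ENNReal.continuous_ofReal.tendsto 1).comp (hc a ha0 ha1)) (Or.inr hcB.ne_top)
  filter_upwards [h2.eventually_const_lt hbc, hpos] with ε hε hε0
  refine hε.trans_le ?_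
  have hsub : Set.Ioo 0 a ⊆ Set.Ioi (0 : ℝ) := fun u hu => hu.1
  have hm := (hρ.integrableOn hε0).aemeasurable
  rw [X.energy_eq hk hp hgm hg hm, ← hρ.setLIntegral_ofReal hε0 measurableSet_Ioo hsub, mul_comm,
    ← lintegral_mul_const'' _ (hm.mono_set hsub).ennreal_ofReal]
  refine (setLIntegral_mono' measurableSet_Ioo fun u hu => ?_).trans (lintegral_mono_set hsub)
  refine mul_le_mul_right (hδ u ?_).le _
  rw [mem_ball_zero_iff, Real.norm_eq_abs, abs_of_pos hu.1]
  exact hu.2.trans_le (min_le_left _ _)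

/-- `y ↦ ‖∂_y^k f‖_X^p` is positively homogeneous of degree `k p`. -/
theorem RINorm.ballEnergy_zero_eq {f : Distr N 𝕜} (hN : 1 ≤ N) (hk : 1 ≤ k) {p : ℝ} (hp : 0 < p)
    (hgm : ∀ α, StronglyMeasurable (g α))
    (hg : ∀ α ∈ multiIndices N k, Represents (partialDeriv α f) (g α)) :
    X.ballEnergy k p g 0 = ENNReal.ofReal (1 / (k * p + N)) *
      ∫⁻ ω : Metric.sphere (0 : E N) 1, X.distNorm (dirDeriv k (ω : E N) f) ^ p
        ∂(volume : Measure (E N)).toSphere := by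
  have hkpos : (0 : ℝ) < k := by positivity
  simp only [X.distNorm_dirDeriv hg]
  refine lintegral_ball_eq_lintegral_sphere hN (by positivity)
    (F := fun y => X.segNorm k g 0 y ^ p)
    ((X.measurable_segNorm hgm (fun α hα => (hg α hα).1) 0).pow_const p) fun t ht y => ?_
  rw [X.segNorm_zero_smul hgm, ENNReal.mul_rpow_of_nonneg _ _ hp.le,
    Real.enorm_eq_ofReal (by positivity), ENNReal.ofReal_rpow_of_pos (by positivity),
    Real.rpow_mul ht.le, Real.rpow_natCast]

end Energy

end BBM

end

theorem mainTheorem6 (𝕜 : Type*) [RCLike 𝕜] (N k : ℕ) (hN : 1 ≤ N) (hk : 1 ≤ k)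
    (p : ℝ) (hp : 0 < p) :
    ∃ C : ℝ≥0, 0 < C ∧
      ∀ X : BBM.RINorm N, X.HasAbsContNorm →
      ∀ ρ : ℝ → ℝ → ℝ, BBM.IsNormalized ρ →
        (∀ f ∈ X.homSobolev k 𝕜, ∀ ε > 0,
          BBM.energy X k p (ρ ε) f ≤ C * X.gradNorm k f ^ p) ∧
        (BBM.Concentrates ρ →
          (∀ f ∈ X.homSobolev k 𝕜,
            Tendsto (fun ε => BBM.energy X k p (ρ ε) f) (𝓝[>] 0)
              (𝓝 (ENNReal.ofReal (1 / (k * p + N)) *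
                ∫⁻ ω : Metric.sphere (0 : BBM.E N) 1,
                  X.distNorm (BBM.dirDeriv k (ω : BBM.E N) f) ^ p
                    ∂(volume : Measure (BBM.E N)).toSphere))) ∧
          (∀ f ∈ X.sobolev k 𝕜, ∃ L : ℝ≥0∞,
            Tendsto (fun ε => BBM.energy X k p (ρ ε) f) (𝓝[>] 0) (𝓝 L) ∧
              L ≤ C * X.gradNorm k f ^ p ∧ X.gradNorm k f ^ p ≤ C * L)) := by
  obtain ⟨C₁, hC₁⟩ := BBM.exists_fullNorm_rpow_le 𝕜 N k hp
  obtain ⟨C₂, hC₂⟩ := BBM.exists_ballEnergy_zero_le 𝕜 N k hp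
  -- every claim is about the integral over the unit ball for a choice of representatives
  have key : ∀ (X : BBM.RINorm N), ∀ f ∈ X.homSobolev k 𝕜, ∃ g : (Fin N → ℕ) → BBM.E N → 𝕜,
      (∀ α, StronglyMeasurable (g α)) ∧
      (∀ α ∈ BBM.multiIndices N k, BBM.Represents (BBM.partialDeriv α f) (g α)) ∧
      X.ballEnergy k p g 0 ≠ ∞ ∧
      X.ballEnergy k p g 0 ≤ (C₁ + C₂ + 1 : ℝ≥0) * X.gradNorm k f ^ p ∧
      X.gradNorm k f ^ p ≤ (C₁ + C₂ + 1 : ℝ≥0) * X.ballEnergy k p g 0 := by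
    intro X f hf
    obtain ⟨g, hgm, hg⟩ := X.exists_represents_of_mem_homSobolev hf
    have hrep := fun α hα => (hg α hα).1
    have hfin : X.fullNorm k g < ∞ := (X.fullNorm_le_sum hgm).trans_lt
      (ENNReal.sum_lt_top.2 fun α hα => (hg α hα).2)
    have hgrad : X.gradNorm k f = X.fullNorm k g := X.gradNorm_eq hrep
    rw [hgrad]
    have h1 := hC₂ X g hgm
    refine ⟨g, hgm, hrep, ?_, ?_, ?_⟩
    · exact (h1.trans_lt (ENNReal.mul_lt_top ENNReal.coe_lt_top
        (ENNReal.rpow_lt_top_of_nonneg hp.le hfin.ne))).ne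
    · refine h1.trans ?_
      gcongr
      exact le_add_right le_add_self
    · refine (hC₁ X g hgm hfin).trans ?_
      rw [BBM.RINorm.ballEnergy]
      gcongr
      exact le_add_right le_self_add
  refine ⟨C₁ + C₂ + 1, by positivity, fun X _ ρ hρ => ⟨fun f hf ε hε => ?_, fun hconc =>
    ⟨fun f hf => ?_, fun f hf => ?_⟩⟩⟩
  · obtain ⟨g, hgm, hg, -, hle, -⟩ := key X f hf
    exact (X.energy_le hk hp hgm hg hρ hε).trans hle
  · obtain ⟨g, hgm, hg, hfin, -, -⟩ := key X f hf
    rw [← X.ballEnergy_zero_eq hN hk hp hgm hg]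
    exact X.tendsto_energy hk hp hgm hg hfin hρ hconc
  · obtain ⟨g, hgm, hg, hfin, hle, hge⟩ := key X f fun α hα => hf α hα.le
    exact ⟨_, X.tendsto_energy hk hp hgm hg hfin hρ hconc, hle, hge⟩
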